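/- **Setting.** Let $(y_i,X_i)_{i\ge 1}$ be iid observations with common law $Q$, where $y_i\in\{1,\dots,K\}$ is the observed choice and $X_i$ are covariates in a measurable space. Let $\Theta\subset\mathbb{R}^p$ be the parameter space, and let $v(X,\theta)\in\mathbb{R}^K$ and $\Sigma(X,\theta)\in\mathbb{R}^{K\times K}$ be the utility vector and scale matrix. With $M=I_K-\frac1K 1_K1_K^\top$ and $\tilde\Sigma=M\Sigma M^\top$, assumed to have $\operatorname{tr}\tilde\Sigma(X,\theta)>0$, put $v^*=\sqrt{K/\operatorname{tr}\tilde\Sigma}\,Mv$ and $\Sigma^*=(K/\operatorname{tr}\tilde\Sigma)\,\tilde\Sigma$. Let $\hat P_j(\cdot,\cdot)$, $j=1,\dots,K$, be a fixed emulator of the choice probabilities (not depending on $n$), positive at the inputs used, and let $$\hat m(y,X;\theta)=\log \hat P_y\{v^*(X,\theta),\Sigma^*(X,\theta)\},\qquad \hat\psi=\nabla_\theta\hat m,$$ $$\mathbb{M}(\theta)=\mathbb{E}\,\hat m(y,X;\theta),\qquad \mathbb{M}_n(\theta)=\frac1n\sum_{i=1}^n\hat m(y_i,X_i;\theta),$$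 where $(y,X)\sim Q$ and $\mathbb{M}(\theta)$ is finite for each $\theta\in\Theta$. Put $$A(\theta)=-\mathbb{E}\{\nabla^2_\theta\hat m(y,X;\theta)\},\qquad B(\theta)=\mathbb{E}\{\hat\psi(y,X;\theta)\hat\psi(y,X;\theta)^\top\}.$$ Let $\hat\theta_n$ be random vectors with values in $\Theta$. **Theorem 6 (Asymptotic normality under misspecification).** Assume: 1. *Identification and uniform convergence.* (i) $\Theta$ is compact. (ii) $\mathbb{M}$ has a unique maximizer $\theta_0^\dagger$ on $\Theta$, and $\theta_0^\dagger$ lies in the interior of $\Theta$. (iii) For every $\epsilon>0$, $\sup_{\theta\in\Theta:\,\|\theta-\theta_0^\dagger\|\ge\epsilon}\mathbb{M}(\theta)<\mathbb{M}(\theta_0^\dagger)$ (the supremum over the empty set being $-\infty$). (iv) $\sup_{\theta\in\Theta}|\mathbb{M}_n(\theta)-\mathbb{M}(\theta)|\to 0$ in probability. (v) $\mathbb{M}_n(\hat\theta_n)\ge\sup_{\theta\in\Theta}\mathbb{M}_n(\theta)-o_p(n^{-1})$. 2. *Regularity.* (i) For each $(y,X)$, $\theta\mapsto\hat m(y,X;\theta)$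 is differentiable on $\Theta$. (ii) There are $\delta>0$ and a measurable $\dot m$ with $\mathbb{E}\{\dot m(y,X)^2\}<\infty$ such that $\|\hat\psi(y,X;\theta)\|\le\dot m(y,X)$ for all $(y,X)$ and all $\theta\in\Theta$ with $\|\theta-\theta_0^\dagger\|\le\delta$. (iii) The Hessian $\nabla^2_\theta\hat m(y,X;\theta_0^\dagger)$ exists almost surely and is integrable, $A(\theta_0^\dagger)$ is positive definite, and as $\theta\to\theta_0^\dagger$ $$\mathbb{M}(\theta)=\mathbb{M}(\theta_0^\dagger)-\tfrac12(\theta-\theta_0^\dagger)^\top A(\theta_0^\dagger)(\theta-\theta_0^\dagger)+o(\|\theta-\theta_0^\dagger\|^2).$$ Then $$\sqrt n\,(\hat\theta_n-\theta_0^\dagger)\xrightarrow{d}\mathcal{N}\bigl(0,\;A(\theta_0^\dagger)^{-1}B(\theta_0^\dagger)A(\theta_0^\dagger)^{-\top}\bigr).$$ -/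

import Mathlib

open MeasureTheory ProbabilityTheory Filter Topology Asymptotics
open scoped Matrix ENNReal

noncomputable section

namespace Emulator

/-- The centering matrix `M = I - (1/K) 1 1ᵀ`. -/
def centering (K : ℕ) : Matrix (Fin K) (Fin K) ℝ :=
  1 - (K : ℝ)⁻¹ • Matrix.of fun _ _ => (1 : ℝ)

/-- The centered scale matrix `M Σ Mᵀ`. -/
def centeredScale {K : ℕ} (S : Matrix (Fin K) (Fin K) ℝ) : Matrix (Fin K) (Fin K) ℝ :=
  centering K * S * (centering K)ᵀ

/-- The normalized utilities `v* = √(K / tr (M Σ Mᵀ)) M v`. -/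
def normUtility {K : ℕ} (v : Fin K → ℝ) (S : Matrix (Fin K) (Fin K) ℝ) : Fin K → ℝ :=
  Real.sqrt ((K : ℝ) / (centeredScale S).trace) • (centering K *ᵥ v)

/-- The normalized scale matrix `Σ* = (K / tr (M Σ Mᵀ)) M Σ Mᵀ`. -/
def normScale {K : ℕ} (S : Matrix (Fin K) (Fin K) ℝ) : Matrix (Fin K) (Fin K) ℝ :=
  ((K : ℝ) / (centeredScale S).trace) • centeredScale S

/-- The emulated probability `P̂_y(v*(X, θ), Σ*(X, θ))` of the choice `y`, where
`Phat j u S` is the output of the (fixed) emulator for alternative `j` at the normalized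
inputs `u`, `S`, and `v`, `S` give utilities and scale matrix from covariates and parameter. -/
def choiceProb {K p : ℕ} {𝒳 : Type*}
    (Phat : Fin K → (Fin K → ℝ) → Matrix (Fin K) (Fin K) ℝ → ℝ)
    (v : 𝒳 → EuclideanSpace ℝ (Fin p) → Fin K → ℝ)
    (S : 𝒳 → EuclideanSpace ℝ (Fin p) → Matrix (Fin K) (Fin K) ℝ)
    (z : Fin K × 𝒳) (θ : EuclideanSpace ℝ (Fin p)) : ℝ :=
  Phat z.1 (normUtility (v z.2 θ) (S z.2 θ)) (normScale (S z.2 θ))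

/-- The emulator log-likelihood contribution `m̂(y, X; θ) = log P̂_y(v*(X, θ), Σ*(X, θ))`. -/
def logLik {K p : ℕ} {𝒳 : Type*}
    (Phat : Fin K → (Fin K → ℝ) → Matrix (Fin K) (Fin K) ℝ → ℝ)
    (v : 𝒳 → EuclideanSpace ℝ (Fin p) → Fin K → ℝ)
    (S : 𝒳 → EuclideanSpace ℝ (Fin p) → Matrix (Fin K) (Fin K) ℝ)
    (z : Fin K × 𝒳) (θ : EuclideanSpace ℝ (Fin p)) : ℝ :=
  Real.log (choiceProb Phat v S z θ)

end Emulator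

namespace MEst

/-- The population criterion `E m(z; θ)`, `z ∼ Q`. -/
def popCrit {Z : Type*} [MeasurableSpace Z] {p : ℕ} (Q : Measure Z)
    (m : Z → EuclideanSpace ℝ (Fin p) → ℝ) (θ : EuclideanSpace ℝ (Fin p)) : ℝ :=
  ∫ z, m z θ ∂Q

/-- The sample criterion `(1/n) ∑_{i<n} m(z_i; θ)` of a data sequence `z`. -/
def sampleCrit {Z : Type*} {p : ℕ} (m : Z → EuclideanSpace ℝ (Fin p) → ℝ) (n : ℕ) (z : ℕ → Z)
    (θ : EuclideanSpace ℝ (Fin p)) : ℝ :=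
  (n : ℝ)⁻¹ * ∑ i ∈ Finset.range n, m (z i) θ

/-- The score `∇_θ m(z; θ)`. -/
def score {Z : Type*} {p : ℕ} (m : Z → EuclideanSpace ℝ (Fin p) → ℝ) (z : Z)
    (θ : EuclideanSpace ℝ (Fin p)) : EuclideanSpace ℝ (Fin p) :=
  gradient (m z) θ

/-- The Hessian matrix `∇²_θ m(z; θ)`: the Jacobian matrix of the score. -/
def hessian {Z : Type*} {p : ℕ} (m : Z → EuclideanSpace ℝ (Fin p) → ℝ) (z : Z)
    (θ : EuclideanSpace ℝ (Fin p)) : Matrix (Fin p) (Fin p) ℝ :=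
  Matrix.of fun i j => (fderiv ℝ (score m z) θ (EuclideanSpace.single j 1)) i

/-- `A(θ) = - E ∇²_θ m(z; θ)`, entrywise. -/
def matA {Z : Type*} [MeasurableSpace Z] {p : ℕ} (Q : Measure Z)
    (m : Z → EuclideanSpace ℝ (Fin p) → ℝ) (θ : EuclideanSpace ℝ (Fin p)) :
    Matrix (Fin p) (Fin p) ℝ :=
  Matrix.of fun i j => -∫ z, hessian m z θ i j ∂Q

/-- `B(θ) = E [s(z; θ) s(z; θ)ᵀ]` with `s` the score, entrywise. -/
def matB {Z : Type*} [MeasurableSpace Z] {p : ℕ} (Q : Measure Z)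
    (m : Z → EuclideanSpace ℝ (Fin p) → ℝ) (θ : EuclideanSpace ℝ (Fin p)) :
    Matrix (Fin p) (Fin p) ℝ :=
  Matrix.of fun i j => ∫ z, score m z θ i * score m z θ j ∂Q

/-- Identification and uniform convergence. `z i` is the `i`-th observation, `Q` the common law
of the observations, `θ₀` the pseudo-true parameter, `θhat n` the estimator at sample size `n`. -/
structure Identification {Ω Z : Type*} [MeasurableSpace Ω] [MeasurableSpace Z] {p : ℕ}
    (P : Measure Ω) (Q : Measure Z) (m : Z → EuclideanSpace ℝ (Fin p) → ℝ)
    (z : ℕ → Ω → Z) (Θ : Set (EuclideanSpace ℝ (Fin p))) (θ₀ : EuclideanSpace ℝ (Fin p))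
    (θhat : ℕ → Ω → EuclideanSpace ℝ (Fin p)) : Prop where
  /-- The parameter space is compact. -/
  compact : IsCompact Θ
  /-- The expectations `E m(z; θ)` exist and are finite. -/
  integrable : ∀ θ ∈ Θ, Integrable (fun x => m x θ) Q
  /-- The pseudo-true parameter is interior... -/
  mem_interior : θ₀ ∈ interior Θ
  /-- ...and is the unique maximizer of the population criterion on `Θ`. -/
  unique_max : ∀ θ ∈ Θ, θ ≠ θ₀ → popCrit Q m θ < popCrit Q m θ₀
  /-- It is well separated. The supremum is taken in the extended reals, so that it is `-∞`
  over the empty set. -/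
  well_separated : ∀ ε : ℝ, 0 < ε →
    (⨆ θ ∈ {θ ∈ Θ | ε ≤ ‖θ - θ₀‖}, (popCrit Q m θ : EReal)) < (popCrit Q m θ₀ : EReal)
  /-- Uniform convergence in probability of the sample criterion, with the supremum taken
  in `[0, ∞]`. -/
  uniform_conv : ∀ ε : ℝ, 0 < ε →
    Tendsto (fun n => P {ω | ENNReal.ofReal ε ≤
      ⨆ θ ∈ Θ, ENNReal.ofReal |sampleCrit m n (fun i => z i ω) θ - popCrit Q m θ|})
      atTop (𝓝 0)
  /-- The estimator takes values in the parameter space. -/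
  mem_param : ∀ n, ∀ᵐ ω ∂P, θhat n ω ∈ Θ
  /-- The estimator maximizes the sample criterion over `Θ` up to an error `r n = o_p(1/n)`. -/
  near_max : ∃ r : ℕ → Ω → ℝ,
    TendstoInMeasure P (fun (n : ℕ) ω => (n : ℝ) * r n ω) atTop (fun _ => 0) ∧
    ∀ n, ∀ᵐ ω ∂P, ∀ θ ∈ Θ,
      sampleCrit m n (fun i => z i ω) θ - r n ω ≤ sampleCrit m n (fun i => z i ω) (θhat n ω)

/-- Regularity for asymptotic normality. -/
structure Regularity {Z : Type*} [MeasurableSpace Z] {p : ℕ}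
    (Q : Measure Z) (m : Z → EuclideanSpace ℝ (Fin p) → ℝ)
    (Θ : Set (EuclideanSpace ℝ (Fin p))) (θ₀ : EuclideanSpace ℝ (Fin p)) : Prop where
  /-- For each observation the criterion is differentiable on `Θ`. -/
  differentiable : ∀ x, DifferentiableOn ℝ (m x) Θ
  /-- Local dominance of the score by a square-integrable function. -/
  dominance : ∃ δ : ℝ, 0 < δ ∧ ∃ mdot : Z → ℝ, Measurable mdot ∧
    Integrable (fun x => mdot x ^ 2) Q ∧
    ∀ x, ∀ θ ∈ Θ, ‖θ - θ₀‖ ≤ δ → ‖score m x θ‖ ≤ mdot x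
  /-- The Hessian at `θ₀` exists for almost every observation... -/
  hessian_exists : ∀ᵐ x ∂Q, DifferentiableAt ℝ (score m x) θ₀
  /-- ...and is integrable, so that `A(θ₀)` is well defined. -/
  hessian_integrable : ∀ i j, Integrable (fun x => hessian m x θ₀ i j) Q
  /-- Second-order Taylor expansion of the population criterion at `θ₀`. -/
  expansion : (fun θ => popCrit Q m θ - (popCrit Q m θ₀ -
      1 / 2 * ((θ - θ₀).ofLp ⬝ᵥ (matA Q m θ₀ *ᵥ (θ - θ₀).ofLp))))
    =o[𝓝 θ₀] fun θ => ‖θ - θ₀‖ ^ 2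
  posDef : (matA Q m θ₀).PosDef

end MEst

end

/-! Write the sample log-likelihood increment as drift plus noise: `n` times the increment of the
population criterion, plus `√n` times the empirical process of `m(·,θ) - m(·,θ₀)` (`sum_sub_eq`).
The drift has the quadratic expansion assumed of the population criterion. At `θ = θ₀ + h/√n` the
noise is, uniformly over bounded `h`, the linear form `⟨Gₙ, h⟩` with `Gₙ` the normalized score sum.
The criterion is thus close to the concave quadratic `⟨Gₙ, h⟩ - ½⟨A h, h⟩`, a near-maximizer must
lie close to its peak `A⁻¹Gₙ`, and the central limit theorem for the score with Slutsky's lemma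
gives the sandwich covariance. Only the population criterion is expanded to second order; the sample
criterion is differentiated once, at `θ₀`, and is otherwise merely Lipschitz near `θ₀`, by dominance
of the score and the mean value inequality.

The analytic core is a maximal inequality for Lipschitz classes on a finite-dimensional ball
(`exists_modulus`). Truncating at `{L ≤ √n}` bounds the summands enough for exponential moments of
the increments, and chaining (`Chaining.exists_bound`) turns these into a bound on the oscillation
off a finite net, uniform in `n`. The truncation costs at most `E L² 1{L > √n}`, which tends to
zero. The bound is used three ways: with the net `{0}` for the local fluctuations and for the score,
and with a fine net, combined with Chebyshev at its points, for the linear remainder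
(`tendsto_sup_remainder`). Suprema over the index are never integrated: they are dominated by
measurable variables `D` of controlled mean, so their measurability is not needed.

Consistency comes from separation and uniform convergence. Peeling into dyadic shells upgrades it to
the rate `n^{-1/2}` (`exists_tight_bound`), which confines the comparison of quadratics to bounded
`h` (`tendsto_linearization`). -/

/-! ### Chaining over nets of a finite-dimensional ball -/

namespace Chaining

variable {E : Type*} [NormedAddCommGroup E] [NormedSpace ℝ E]

/-- Iterated nets: `net C j` consists of the sums `∑ k < j, 2⁻ᵏ c k` with `c k ∈ C`. -/
noncomputable def net [DecidableEq E] (C : Finset E) : ℕ → Finset E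
  | 0 => {0}
  | j + 1 => Finset.image₂ (fun t c => t + (2⁻¹ : ℝ) ^ j • c) (net C j) C

lemma card_net_le [DecidableEq E] (C : Finset E) (j : ℕ) : (net C j).card ≤ C.card ^ j := by
  induction j with
  | zero => simp [net]
  | succ j ih =>
    rw [net, pow_succ]
    exact (Finset.card_image₂_le _ _ _).trans (Nat.mul_le_mul_right _ ih)

/-- A geometric sum. It keeps every chain inside the ball of radius 2, which is why later hypotheses
concern that ball although suprema run over the unit ball. -/
lemma norm_le_of_mem_net [DecidableEq E] {C : Finset E} (hC : ∀ c ∈ C, ‖c‖ ≤ 1) (j : ℕ) :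
    ∀ t ∈ net C j, ‖t‖ ≤ 2 - 2 * 2⁻¹ ^ j := by
  induction j with
  | zero => simp [net]
  | succ j ih =>
    intro t ht
    obtain ⟨t', ht', c, hc, rfl⟩ := Finset.mem_image₂.1 ht
    have h1 := ih t' ht'
    have h2 : ‖(2⁻¹ : ℝ) ^ j • c‖ ≤ 2⁻¹ ^ j := by
      rw [norm_smul, norm_pow, norm_inv, Real.norm_ofNat]
      exact mul_le_of_le_one_right (by positivity) (hC c hc)
    have h3 := norm_add_le t' ((2⁻¹ : ℝ) ^ j • c)
    rw [pow_succ]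
    linarith

/-- The half-covering of the unit ball is applied to the error `s - t` rescaled by `2ʲ`, so each
step halves the error. -/
lemma exists_near_step {C : Finset E} (hcov : ∀ s : E, ‖s‖ ≤ 1 → ∃ c ∈ C, ‖s - c‖ ≤ 2⁻¹)
    {s t : E} {j : ℕ} (h : ‖s - t‖ ≤ 2⁻¹ ^ j) :
    ∃ c ∈ C, ‖s - (t + (2⁻¹ : ℝ) ^ j • c)‖ ≤ 2⁻¹ ^ (j + 1) := by
  have h2 : (0 : ℝ) < 2⁻¹ ^ j := by positivity
  obtain ⟨c, hc, hsc⟩ := hcov (((2⁻¹ : ℝ) ^ j)⁻¹ • (s - t)) (by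
    rw [norm_smul, Real.norm_of_nonneg (by positivity), inv_mul_le_iff₀ h2, mul_one]
    exact h)
  refine ⟨c, hc, ?_⟩
  have : s - (t + (2⁻¹ : ℝ) ^ j • c)
      = (2⁻¹ : ℝ) ^ j • (((2⁻¹ : ℝ) ^ j)⁻¹ • (s - t) - c) := by
    rw [smul_sub, smul_smul, mul_inv_cancel₀ h2.ne', one_smul]; abel
  rw [this, norm_smul, Real.norm_of_nonneg h2.le, pow_succ]
  gcongr

lemma exists_half_cover [FiniteDimensional ℝ E] :
    ∃ C : Finset E, C.Nonempty ∧ (∀ c ∈ C, ‖c‖ ≤ 1) ∧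
      ∀ s : E, ‖s‖ ≤ 1 → ∃ c ∈ C, ‖s - c‖ ≤ 2⁻¹ := by
  have := FiniteDimensional.proper ℝ E
  obtain ⟨t, hts, htf, hcov⟩ := (isCompact_closedBall (0 : E) 1).finite_cover_balls
    (e := 2⁻¹) (by norm_num)
  have key : ∀ s : E, ‖s‖ ≤ 1 → ∃ c ∈ htf.toFinset, ‖s - c‖ ≤ 2⁻¹ := by
    intro s hs
    obtain ⟨c, hc, hsc⟩ := Set.mem_iUnion₂.1 (hcov (mem_closedBall_zero_iff.2 hs))
    exact ⟨c, htf.mem_toFinset.2 hc, by rw [← dist_eq_norm]; exact (Metric.mem_ball.1 hsc).le⟩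
  refine ⟨htf.toFinset, ?_, fun c hc => ?_, key⟩
  · obtain ⟨c, hc, -⟩ := key 0 (by simp)
    exact ⟨c, hc⟩
  · exact mem_closedBall_zero_iff.1 (hts (htf.mem_toFinset.1 hc))

variable {Ω : Type*}

/-- The bound on the oscillation of `X` along one chaining step. -/
noncomputable def stepBound [DecidableEq E] (C : Finset E) (X : E → Ω → ℝ) (j : ℕ) (ω : Ω) : ℝ≥0∞ :=
  ENNReal.ofReal (2⁻¹ ^ j) * (ENNReal.ofReal ((j + 1) * Real.log C.card) +
    ((C.card : ℝ≥0∞) ^ (j + 1))⁻¹ * ∑ t ∈ net C j, ∑ c ∈ C,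
      ENNReal.ofReal (Real.exp (|X t ω - X (t + (2⁻¹ : ℝ) ^ j • c) ω| / 2⁻¹ ^ j)))

/-- The tangent inequality `1 + u ≤ eᵘ` at `u = x/d - log M` gives `x ≤ d (log M + e^{x/d}/M)`. With
`M = |C|^{j+1}`, which bounds the number of links at level `j`, one exponential is dominated by the
sum over all links; the maximum then costs only `log M` in expectation. -/
lemma le_stepBound [DecidableEq E] {C : Finset E} (X : E → Ω → ℝ) {j : ℕ} {t c : E}
    (ht : t ∈ net C j) (hc : c ∈ C) (ω : Ω) :
    ENNReal.ofReal |X t ω - X (t + (2⁻¹ : ℝ) ^ j • c) ω| ≤ stepBound C X j ω := by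
  set x := |X t ω - X (t + (2⁻¹ : ℝ) ^ j • c) ω| with hx
  have hd : (0 : ℝ) < 2⁻¹ ^ j := by positivity
  have hN : (0 : ℝ) < C.card := by exact_mod_cast Finset.card_pos.2 ⟨c, hc⟩
  have hN1 : (1 : ℝ) ≤ C.card := by exact_mod_cast Finset.card_pos.2 ⟨c, hc⟩
  have hlog : 0 ≤ ((j : ℝ) + 1) * Real.log C.card :=
    mul_nonneg (by positivity) (Real.log_nonneg hN1)
  have key : x ≤ 2⁻¹ ^ j * ((j + 1) * Real.log C.card +
      ((C.card : ℝ) ^ (j + 1))⁻¹ * Real.exp (x / 2⁻¹ ^ j)) := by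
    rw [← div_le_iff₀' hd]
    have h1 := Real.add_one_le_exp (x / 2⁻¹ ^ j - (j + 1) * Real.log C.card)
    have h2 : Real.exp (x / 2⁻¹ ^ j - (j + 1) * Real.log C.card)
        = ((C.card : ℝ) ^ (j + 1))⁻¹ * Real.exp (x / 2⁻¹ ^ j) := by
      rw [Real.exp_sub, mul_comm ((j : ℝ) + 1), Real.exp_mul, Real.exp_log hN]
      norm_cast
      rw [div_eq_inv_mul]
    linarith
  calc ENNReal.ofReal x ≤ _ := ENNReal.ofReal_le_ofReal key
    _ = ENNReal.ofReal (2⁻¹ ^ j) * (ENNReal.ofReal ((j + 1) * Real.log C.card) +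
        ((C.card : ℝ≥0∞) ^ (j + 1))⁻¹ * ENNReal.ofReal (Real.exp (x / 2⁻¹ ^ j))) := by
      rw [ENNReal.ofReal_mul hd.le, ENNReal.ofReal_add hlog (by positivity),
        ENNReal.ofReal_mul (p := ((C.card : ℝ) ^ (j + 1))⁻¹) (by positivity),
        ENNReal.ofReal_inv_of_pos (by positivity), ENNReal.ofReal_pow hN.le, ENNReal.ofReal_natCast]
    _ ≤ stepBound C X j ω := by
      unfold stepBound
      gcongr
      refine le_trans ?_ (Finset.single_le_sum (f := fun t => ∑ c ∈ C,
        ENNReal.ofReal (Real.exp (|X t ω - X (t + (2⁻¹ : ℝ) ^ j • c) ω| / 2⁻¹ ^ j)))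
        (fun _ _ => zero_le) ht)
      exact Finset.single_le_sum (f := fun c =>
        ENNReal.ofReal (Real.exp (|X t ω - X (t + (2⁻¹ : ℝ) ^ j • c) ω| / 2⁻¹ ^ j)))
        (fun _ _ => zero_le) hc

variable [MeasurableSpace Ω]

/-- **Chaining bound** for processes with exponentially integrable increments. -/
theorem exists_bound [FiniteDimensional ℝ E] (P : Measure Ω) [IsProbabilityMeasure P] (B : ℝ) :
    ∃ (T : ℕ → Finset E) (ε : ℕ → ℝ≥0∞), T 0 = {0} ∧ (∀ j, ∀ t ∈ T j, ‖t‖ ≤ 2) ∧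
      (∀ j, ε j ≠ ⊤) ∧ Tendsto ε atTop (𝓝 0) ∧
      ∀ X : E → Ω → ℝ, (∀ t, ‖t‖ ≤ 2 → AEMeasurable (X t) P) →
        (∀ ω, ContinuousOn (fun t => X t ω) (Metric.closedBall 0 2)) →
        (∀ s t d, ‖s‖ ≤ 2 → ‖t‖ ≤ 2 → 0 < d → ‖s - t‖ ≤ d →
          ∫⁻ ω, ENNReal.ofReal (Real.exp (|X s ω - X t ω| / d)) ∂P ≤ ENNReal.ofReal B) →
        ∀ J, ∃ D : Ω → ℝ≥0∞, AEMeasurable D P ∧ ∫⁻ ω, D ω ∂P ≤ ε J ∧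
          ∀ ω s, ‖s‖ ≤ 1 → ∃ t ∈ T J, ‖s - t‖ ≤ 1 ∧ ENNReal.ofReal |X s ω - X t ω| ≤ D ω := by
  classical
  obtain ⟨C, hCne, hC1, hcov⟩ := exists_half_cover (E := E)
  set l := Real.log C.card with hl
  have hN0 : (C.card : ℝ≥0∞) ≠ 0 := by simpa using hCne.ne_empty
  have hl0 : 0 ≤ l := Real.log_nonneg (by exact_mod_cast hCne.card_pos)
  -- `B` may be negative, and the bounds `e j` must not be.
  set B' := max B 0 with hB'
  have hB0 : 0 ≤ B' := le_max_right _ _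
  -- Bound on the expected step at level `j`. The entropy grows linearly in `j` while the scale
  -- decays geometrically, so the series converges and its tails serve as `ε`.
  let e : ℕ → ℝ := fun j => 2⁻¹ ^ j * ((j + 1) * l + B')
  have he0 : ∀ j, 0 ≤ e j := fun j => by positivity
  have hes : Summable e := by
    have h1 : Summable fun j : ℕ => (j : ℝ) ^ 1 * (2⁻¹ : ℝ) ^ j :=
      summable_pow_mul_geometric_of_norm_lt_one 1 (by norm_num)
    have h2 : Summable fun j : ℕ => (2⁻¹ : ℝ) ^ j :=
      summable_geometric_of_lt_one (by norm_num) (by norm_num)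
    refine ((h1.mul_left l).add (h2.mul_left (l + B'))).congr fun j => ?_
    simp only [e]; ring
  have hfin : ∑' j, ENNReal.ofReal (e j) ≠ ⊤ := by
    rw [← ENNReal.ofReal_tsum_of_nonneg he0 hes]; exact ENNReal.ofReal_ne_top
  have hT2 : ∀ j, ∀ t ∈ net C j, ‖t‖ ≤ 2 := fun j t ht =>
    (norm_le_of_mem_net hC1 j t ht).trans (by have : (0 : ℝ) ≤ 2⁻¹ ^ j := by positivity
                                              linarith)
  refine ⟨net C, fun J => ∑' j, ENNReal.ofReal (e (j + J)), rfl, hT2, fun J => ?_, ?_, ?_⟩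
  · exact ne_top_of_le_ne_top hfin (ENNReal.tsum_comp_le_tsum_of_injective
      (add_left_injective J) (fun j => ENNReal.ofReal (e j)))
  · exact ENNReal.tendsto_sum_nat_add (fun j => ENNReal.ofReal (e j)) hfin
  intro X hXm hXc hinc J
  have hstep_mem : ∀ {j t c}, t ∈ net C j → c ∈ C → t + (2⁻¹ : ℝ) ^ j • c ∈ net C (j + 1) :=
    fun ht hc => Finset.mem_image₂_of_mem ht hc
  have hterm : ∀ {j t c}, t ∈ net C j → c ∈ C → AEMeasurable (fun ω =>
      ENNReal.ofReal (Real.exp (|X t ω - X (t + (2⁻¹ : ℝ) ^ j • c) ω| / 2⁻¹ ^ j))) P := by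
    intro j t c ht hc
    have h1 := hXm t (hT2 j t ht)
    have h2 := hXm _ (hT2 _ _ (hstep_mem ht hc))
    have h3 : AEMeasurable (fun ω => |X t ω - X (t + (2⁻¹ : ℝ) ^ j • c) ω|) P :=
      continuous_abs.measurable.comp_aemeasurable (h1.sub h2)
    exact (Real.measurable_exp.comp_aemeasurable (h3.div_const _)).ennreal_ofReal
  have hsum : ∀ j, AEMeasurable (fun ω => ∑ t ∈ net C j, ∑ c ∈ C,
      ENNReal.ofReal (Real.exp (|X t ω - X (t + (2⁻¹ : ℝ) ^ j • c) ω| / 2⁻¹ ^ j))) P :=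
    fun j => Finset.aemeasurable_fun_sum _ fun t ht => Finset.aemeasurable_fun_sum _ fun c hc =>
      hterm ht hc
  have hDm : ∀ j, AEMeasurable (stepBound C X j) P := fun j =>
    (((hsum j).const_mul _).const_add _).const_mul _
  have hDint : ∀ j, ∫⁻ ω, stepBound C X j ω ∂P ≤ ENNReal.ofReal (e j) := by
    intro j
    unfold stepBound
    rw [lintegral_const_mul'' _ (((hsum j).const_mul _).const_add _),
      lintegral_add_left measurable_const, lintegral_const, measure_univ, mul_one,
      lintegral_const_mul'' _ (hsum j), lintegral_finsetSum' _ (fun t ht =>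
        Finset.aemeasurable_fun_sum _ fun c hc => hterm ht hc)]
    simp only [e]
    rw [ENNReal.ofReal_mul (p := 2⁻¹ ^ j) (by positivity),
      ENNReal.ofReal_add (by positivity) hB0]
    gcongr
    have hle : ∀ t ∈ net C j, ∫⁻ ω, ∑ c ∈ C, ENNReal.ofReal
        (Real.exp (|X t ω - X (t + (2⁻¹ : ℝ) ^ j • c) ω| / 2⁻¹ ^ j)) ∂P
          ≤ C.card * ENNReal.ofReal B' := by
      intro t ht
      rw [lintegral_finsetSum' _ fun c hc => hterm ht hc]
      refine (Finset.sum_le_card_nsmul _ _ (ENNReal.ofReal B') fun c hc => ?_).trans_eq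
        (nsmul_eq_mul _ _)
      -- The increment hypothesis is used with `d = 2⁻ʲ`, not with the length of the link, which can
      -- be zero.
      refine (hinc t _ _ (hT2 j t ht) (hT2 _ _ (hstep_mem ht hc)) (by positivity) ?_).trans
        (ENNReal.ofReal_le_ofReal (le_max_left _ _))
      rw [sub_add_cancel_left, norm_neg, norm_smul, norm_pow, norm_inv, Real.norm_ofNat]
      exact mul_le_of_le_one_right (by positivity) (hC1 c hc)
    calc ((C.card : ℝ≥0∞) ^ (j + 1))⁻¹ * _
        ≤ ((C.card : ℝ≥0∞) ^ (j + 1))⁻¹ * ((C.card : ℝ≥0∞) ^ (j + 1) * ENNReal.ofReal B') := by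
          gcongr
          refine (Finset.sum_le_card_nsmul _ _ _ hle).trans ?_
          rw [nsmul_eq_mul, ← mul_assoc, pow_succ]
          gcongr
          exact_mod_cast card_net_le C j
      _ = ENNReal.ofReal B' := by
          rw [← mul_assoc, ENNReal.inv_mul_cancel (pow_ne_zero _ hN0)
            (ENNReal.pow_ne_top (ENNReal.natCast_ne_top _)), one_mul]
  refine ⟨fun ω => ∑' j, stepBound C X (j + J) ω, AEMeasurable.tsum fun j => hDm _, ?_, ?_⟩
  · rw [lintegral_tsum fun j => hDm _]
    exact ENNReal.tsum_le_tsum fun j => hDint _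
  intro ω s hs
  -- Greedy chain from `0` towards `s`, one net point per level.
  have hchain : ∃ τ : ℕ → E, ∀ j, (τ j ∈ net C j ∧ ‖s - τ j‖ ≤ 2⁻¹ ^ j) ∧
      ∃ c ∈ C, τ (j + 1) = τ j + (2⁻¹ : ℝ) ^ j • c := by
    choose! f hfC hf using fun (j : ℕ) (t : E) (h : ‖s - t‖ ≤ 2⁻¹ ^ j) =>
      exists_near_step hcov h
    let τ : ℕ → E := fun j => Nat.rec 0 (fun k t => t + (2⁻¹ : ℝ) ^ k • f k t) j
    have hτ : ∀ j, τ (j + 1) = τ j + (2⁻¹ : ℝ) ^ j • f j (τ j) := fun j => rfl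
    have h : ∀ j, τ j ∈ net C j ∧ ‖s - τ j‖ ≤ 2⁻¹ ^ j := by
      intro j
      induction j with
      | zero => exact ⟨by simp [net, τ], by simpa [τ] using hs⟩
      | succ j ih =>
        rw [hτ]
        exact ⟨hstep_mem ih.1 (hfC j _ ih.2), hf j _ ih.2⟩
    exact ⟨τ, fun j => ⟨h j, _, hfC j _ (h j).2, hτ j⟩⟩
  obtain ⟨τ, hτ⟩ := hchain
  refine ⟨τ J, (hτ J).1.1, (hτ J).1.2.trans (pow_le_one₀ (by norm_num) (by norm_num)), ?_⟩
  have hpart : ∀ k, ENNReal.ofReal |X (τ (k + J)) ω - X (τ J) ω|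
      ≤ ∑ j ∈ Finset.range k, stepBound C X (j + J) ω := by
    intro k
    induction k with
    | zero => simp
    | succ k ih =>
      rw [Finset.sum_range_succ]
      obtain ⟨c, hc, hk⟩ := (hτ (k + J)).2
      have h1 := le_stepBound X (hτ (k + J)).1.1 hc ω
      rw [← hk] at h1
      calc _ ≤ ENNReal.ofReal (|X (τ (k + J)) ω - X (τ J) ω|
              + |X (τ (k + J)) ω - X (τ (k + J + 1)) ω|) := by
            apply ENNReal.ofReal_le_ofReal
            rw [show k + 1 + J = k + J + 1 by ring, abs_sub_comm (X (τ (k + J)) ω)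
              (X (τ (k + J + 1)) ω), add_comm |_|]
            exact abs_sub_le _ _ _
        _ ≤ _ := ENNReal.ofReal_add_le.trans (add_le_add ih h1)
  have hlim : Tendsto τ atTop (𝓝 s) := by
    rw [tendsto_iff_norm_sub_tendsto_zero]
    refine squeeze_zero (fun _ => norm_nonneg _) (fun j => ?_)
      (tendsto_pow_atTop_nhds_zero_of_lt_one (r := (2⁻¹ : ℝ)) (by norm_num) (by norm_num))
    rw [norm_sub_rev]; exact (hτ j).1.2
  -- Path continuity passes from the telescoped bounds along the chain to `s` itself, which need not
  -- lie in any net.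
  have hXlim : Tendsto (fun k => X (τ (k + J)) ω) atTop (𝓝 (X s ω)) := by
    have h1 := hXc ω s (mem_closedBall_zero_iff.2 (hs.trans (by norm_num)))
    have h2 : Tendsto (fun k => τ (k + J)) atTop (𝓝[Metric.closedBall 0 2] s) :=
      tendsto_nhdsWithin_iff.2 ⟨hlim.comp (tendsto_add_atTop_nat J), Eventually.of_forall
        fun k => mem_closedBall_zero_iff.2 (hT2 _ _ (hτ _).1.1)⟩
    exact h1.tendsto.comp h2
  refine le_of_tendsto' (ENNReal.tendsto_ofReal ((hXlim.sub_const _).abs)) fun k => ?_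
  exact (hpart k).trans (ENNReal.sum_le_tsum _)

end Chaining

/-! ### Empirical process: Chebyshev bound and exponential moments -/

namespace EmpiricalProcess

variable {Ω Z : Type*} [MeasurableSpace Z]

/-- The empirical process `𝔾ₙ f = n^{-1/2} ∑_{i<n} (f(zᵢ) - E f)`. -/
noncomputable def empProc (Q : Measure Z) (z : ℕ → Ω → Z) (n : ℕ) (f : Z → ℝ) (ω : Ω) : ℝ :=
  (√n)⁻¹ * ∑ i ∈ Finset.range n, (f (z i ω) - ∫ x, f x ∂Q)

variable {Q : Measure Z} {z : ℕ → Ω → Z}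

lemma empProc_sub (n : ℕ) {f g : Z → ℝ} (hf : Integrable f Q) (hg : Integrable g Q) (ω : Ω) :
    empProc Q z n (fun x => f x - g x) ω = empProc Q z n f ω - empProc Q z n g ω := by
  simp only [empProc]
  rw [integral_sub hf hg, ← mul_sub, ← Finset.sum_sub_distrib]
  congr 1
  exact Finset.sum_congr rfl fun i _ => by ring

lemma empProc_const_mul (n : ℕ) (c : ℝ) (f : Z → ℝ) (ω : Ω) :
    empProc Q z n (fun x => c * f x) ω = c * empProc Q z n f ω := by
  simp only [empProc, integral_const_mul, ← mul_sub, ← Finset.mul_sum]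
  rw [mul_left_comm]

variable [MeasurableSpace Ω] {P : Measure Ω}

lemma aemeasurable_comp (hlaw : ∀ i, HasLaw (z i) Q P) {E : Type*} [TopologicalSpace E]
    [TopologicalSpace.PseudoMetrizableSpace E] [MeasurableSpace E] [BorelSpace E] {f : Z → E}
    (hf : AEStronglyMeasurable f Q) (i : ℕ) : AEMeasurable (fun ω => f (z i ω)) P := by
  have h := hf.aemeasurable
  rw [← (hlaw i).map_eq] at h
  exact h.comp_aemeasurable (hlaw i).aemeasurable

lemma iIndepFun_comp (hlaw : ∀ i, HasLaw (z i) Q P) (hindep : iIndepFun z P) {E : Type*}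
    [TopologicalSpace E] [TopologicalSpace.PseudoMetrizableSpace E] [MeasurableSpace E]
    [BorelSpace E] {f : Z → E} (hf : AEStronglyMeasurable f Q) :
    iIndepFun (fun i ω => f (z i ω)) P :=
  hindep.comp₀ (fun _ => f) (fun i => (hlaw i).aemeasurable) fun i => by
    rw [(hlaw i).map_eq]; exact hf.aemeasurable

lemma aemeasurable_empProc (hlaw : ∀ i, HasLaw (z i) Q P) (n : ℕ) {f : Z → ℝ}
    (hf : AEStronglyMeasurable f Q) : AEMeasurable (empProc Q z n f) P :=
  (Finset.aemeasurable_fun_sum _ fun i _ => (aemeasurable_comp hlaw hf i).sub_const _).const_mul _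

/-- Chebyshev's inequality for the empirical process. -/
lemma meas_empProc_ge_le [IsProbabilityMeasure P] (hlaw : ∀ i, HasLaw (z i) Q P) (hindep : iIndepFun z P)
    {n : ℕ} (hn : 0 < n) {f : Z → ℝ} (hf : MemLp f 2 Q) {η : ℝ} (hη : 0 < η) :
    P {ω | η ≤ |empProc Q z n f ω|} ≤ ENNReal.ofReal ((∫ x, f x ^ 2 ∂Q) / η ^ 2) := by
  have hn' : (0 : ℝ) < n := by exact_mod_cast hn
  have hLp : ∀ i, MemLp (fun ω => f (z i ω)) 2 P := fun i => by
    have h := hf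
    rw [← (hlaw i).map_eq] at h
    exact h.comp_of_map (hlaw i).aemeasurable
  have hmean : ∀ i, ∫ ω, f (z i ω) ∂P = ∫ x, f x ∂Q := fun i => (hlaw i).integral_comp hf.1
  have hvar : ∀ i, Var[fun ω => f (z i ω); P] ≤ ∫ x, f x ^ 2 ∂Q := fun i => by
    refine (variance_le_expectation_sq (hLp i).1).trans_eq ?_
    exact (hlaw i).integral_comp (f := fun x => f x ^ 2) (hf.1.pow 2)
  set S : Ω → ℝ := ∑ i ∈ Finset.range n, fun ω => f (z i ω) with hS
  have hSLp : MemLp S 2 P := memLp_finsetSum' _ fun i _ => hLp i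
  have hSmean : ∫ ω, S ω ∂P = n * ∫ x, f x ∂Q := by
    simp only [hS, Finset.sum_apply]
    rw [integral_finsetSum _ fun i _ => (hLp i).integrable one_le_two]
    simp [hmean]
  have hSvar : Var[S; P] ≤ n * ∫ x, f x ^ 2 ∂Q := by
    rw [hS, IndepFun.variance_sum (fun i _ => hLp i) fun i _ j _ hij =>
      (iIndepFun_comp hlaw hindep hf.1).indepFun hij]
    refine (Finset.sum_le_card_nsmul _ _ _ fun i _ => hvar i).trans_eq ?_
    simp
  have hset : {ω | η ≤ |empProc Q z n f ω|} = {ω | η * √n ≤ |S ω - P[S]|} := by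
    ext ω
    have hsn : 0 < √(n : ℝ) := Real.sqrt_pos.2 hn'
    simp only [Set.mem_ofPred_eq, empProc]
    rw [hSmean, abs_mul, abs_of_pos (inv_pos.2 hsn), inv_mul_eq_div, le_div_iff₀ hsn,
      Finset.sum_sub_distrib]
    simp [hS]
  rw [hset]
  refine (meas_ge_le_variance_div_sq hSLp (by positivity)).trans (ENNReal.ofReal_le_ofReal ?_)
  rw [mul_pow, Real.sq_sqrt hn'.le, div_le_div_iff₀ (by positivity) (by positivity)]
  nlinarith [sq_nonneg η, mul_le_mul_of_nonneg_right hSvar (sq_nonneg η)]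

variable [IsProbabilityMeasure P] [IsProbabilityMeasure Q]

/-- Bernstein's argument: `eᵘ ≤ 1 + u + u²` for `|u| ≤ 1` bounds one centered factor by `1 + v ≤
eᵛ`, and independence multiplies the factors. -/
lemma lintegral_exp_sum_le (hlaw : ∀ i, HasLaw (z i) Q P) (hindep : iIndepFun z P) {h : Z → ℝ}
    (hm : AEStronglyMeasurable h Q) (h1 : ∀ x, |h x| ≤ 1) (h0 : ∫ x, h x ∂Q = 0) {v : ℝ}
    (hv : ∫ x, h x ^ 2 ∂Q ≤ v) (n : ℕ) :
    ∫⁻ ω, ENNReal.ofReal (Real.exp (∑ i ∈ Finset.range n, h (z i ω))) ∂P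
      ≤ ENNReal.ofReal (Real.exp (n * v)) := by
  have hint : Integrable h Q := Integrable.of_bound hm 1 (Eventually.of_forall h1)
  have hint2 : Integrable (fun x => h x ^ 2) Q :=
    Integrable.of_bound (hm.pow 2) 1 (Eventually.of_forall fun x => by
      rw [Real.norm_eq_abs, abs_pow]; exact pow_le_one₀ (abs_nonneg _) (h1 x))
  have hexpm : AEStronglyMeasurable (fun x => Real.exp (h x)) Q :=
    Real.continuous_exp.comp_aestronglyMeasurable hm
  have hexp : Integrable (fun x => Real.exp (h x)) Q :=
    Integrable.of_bound hexpm (Real.exp 1) (Eventually.of_forall fun x => by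
      rw [Real.norm_of_nonneg (Real.exp_pos _).le, Real.exp_le_exp]
      exact (le_abs_self _).trans (h1 x))
  have hle : ∫ x, Real.exp (h x) ∂Q ≤ Real.exp v := by
    calc ∫ x, Real.exp (h x) ∂Q ≤ ∫ x, ((1 + h x) + h x ^ 2) ∂Q := by
          refine integral_mono hexp (((integrable_const 1).add hint).add hint2) fun x => ?_
          have := (abs_le.1 (Real.abs_exp_sub_one_sub_id_le (h1 x))).2
          simp only
          linarith
      _ = 1 + ∫ x, h x ^ 2 ∂Q := by
          rw [integral_add (f := fun x => 1 + h x) ((integrable_const 1).add hint) hint2,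
            integral_add (integrable_const 1) hint, h0]
          simp
      _ ≤ Real.exp v := by linarith [Real.add_one_le_exp v]
  have hmeas := fun i => aemeasurable_comp hlaw hm i
  have hmgf := (iIndepFun_comp hlaw hindep hm).mgf_sum₀ (t := 1) hmeas (Finset.range n)
  have hone : ∀ i, mgf (fun ω => h (z i ω)) P 1 = ∫ x, Real.exp (h x) ∂Q := fun i => by
    simp only [mgf, one_mul]
    exact (hlaw i).integral_comp hexpm
  simp only [hone, Finset.prod_const, Finset.card_range] at hmgf
  simp only [mgf, one_mul, Finset.sum_apply] at hmgf
  have hSm : AEMeasurable (fun ω => ∑ i ∈ Finset.range n, h (z i ω)) P :=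
    Finset.aemeasurable_fun_sum _ fun i _ => hmeas i
  have hSint : Integrable (fun ω => Real.exp (∑ i ∈ Finset.range n, h (z i ω))) P := by
    refine Integrable.of_bound hSm.exp.aestronglyMeasurable (Real.exp n)
      (Eventually.of_forall fun ω => ?_)
    rw [Real.norm_of_nonneg (Real.exp_pos _).le, Real.exp_le_exp]
    calc ∑ i ∈ Finset.range n, h (z i ω) ≤ ∑ i ∈ Finset.range n, 1 :=
          Finset.sum_le_sum fun i _ => (le_abs_self _).trans (h1 _)
      _ = n := by simp
  rw [← ofReal_integral_eq_lintegral_ofReal hSint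
    (Eventually.of_forall fun ω => (Real.exp_pos _).le), hmgf, Real.exp_nat_mul]
  exact ENNReal.ofReal_le_ofReal
    (pow_le_pow_left₀ (integral_nonneg fun x => (Real.exp_pos _).le) hle n)

/-- Since `e^{|u|} ≤ eᵘ + e⁻ᵘ`, the one-sided bound for `h` and `-h` suffices. -/
lemma lintegral_exp_abs_sum_le (hlaw : ∀ i, HasLaw (z i) Q P) (hindep : iIndepFun z P) {h : Z → ℝ}
    (hm : AEStronglyMeasurable h Q) (h1 : ∀ x, |h x| ≤ 1) (h0 : ∫ x, h x ∂Q = 0) {v : ℝ}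
    (hv : ∫ x, h x ^ 2 ∂Q ≤ v) (n : ℕ) :
    ∫⁻ ω, ENNReal.ofReal (Real.exp |∑ i ∈ Finset.range n, h (z i ω)|) ∂P
      ≤ ENNReal.ofReal (2 * Real.exp (n * v)) := by
  have hp := lintegral_exp_sum_le hlaw hindep hm h1 h0 hv n
  have hn := lintegral_exp_sum_le hlaw hindep (h := fun x => -h x) hm.neg
    (fun x => by rw [abs_neg]; exact h1 x) (by rw [integral_neg, h0, neg_zero])
    (v := v) (by simpa using hv) n
  rw [two_mul, ENNReal.ofReal_add (Real.exp_pos _).le (Real.exp_pos _).le]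
  refine le_trans ?_ (add_le_add hp hn)
  have hSm : AEMeasurable (fun ω => ∑ i ∈ Finset.range n, h (z i ω)) P :=
    Finset.aemeasurable_fun_sum _ fun i _ => aemeasurable_comp hlaw hm i
  rw [← lintegral_add_left' hSm.exp.ennreal_ofReal]
  refine lintegral_mono fun ω => ?_
  rw [← ENNReal.ofReal_add (Real.exp_pos _).le (Real.exp_pos _).le, Finset.sum_neg_distrib]
  exact ENNReal.ofReal_le_ofReal (Real.exp_abs_le _)

/-- Exponential integrability of the empirical process at bounded functions. -/
theorem lintegral_exp_abs_empProc_le (hlaw : ∀ i, HasLaw (z i) Q P) (hindep : iIndepFun z P)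
    {n : ℕ} (hn : 0 < n) {f : Z → ℝ} (hm : AEStronglyMeasurable f Q) {d V : ℝ} (hd : 0 < d)
    (hb : ∀ x, |f x| ≤ d * √n) (hV : ∫ x, f x ^ 2 ∂Q ≤ d ^ 2 * V) :
    ∫⁻ ω, ENNReal.ofReal (Real.exp (|empProc Q z n f ω| / (2 * d))) ∂P
      ≤ ENNReal.ofReal (2 * Real.exp (V / 4)) := by
  have hn' : (0 : ℝ) < n := by exact_mod_cast hn
  have hsn : 0 < √(n : ℝ) := Real.sqrt_pos.2 hn'
  -- Centering can double the bound `d√n`, so division by `2d√n` brings the summands into `[-1, 1]`.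
  -- Their variance is then at most `V/(4n)`, and `n` of them give the exponent `V/4`.
  set a := 2 * d * √(n : ℝ) with ha
  have hapos : 0 < a := by positivity
  set μ := ∫ x, f x ∂Q with hμ
  have hint : Integrable f Q := Integrable.of_bound hm _ (Eventually.of_forall hb)
  have hμb : |μ| ≤ d * √n := by
    have := norm_integral_le_of_norm_le_const (μ := Q) (f := f) (C := d * √n)
      (Eventually.of_forall hb)
    simpa using this
  have hcm : AEStronglyMeasurable (fun x => f x - μ) Q := hm.sub aestronglyMeasurable_const
  have key := lintegral_exp_abs_sum_le hlaw hindep (h := fun x => (f x - μ) / a) (v := V / (4 * n))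
    (by simpa only [div_eq_mul_inv] using hcm.mul_const a⁻¹) (fun x => by
      rw [abs_div, abs_of_pos hapos, div_le_one hapos]
      calc |f x - μ| ≤ |f x| + |μ| := abs_sub _ _
        _ ≤ a := by linarith [hb x]) (by
      rw [integral_div, integral_sub hint (integrable_const _)]; simp [hμ]) (by
      simp_rw [div_pow]
      rw [integral_div, ← variance_eq_integral hm.aemeasurable]
      have h1 : Var[f; Q] ≤ d ^ 2 * V := (variance_le_expectation_sq hm).trans hV
      rw [div_le_div_iff₀ (by positivity) (by positivity), ha, mul_pow, mul_pow,
        Real.sq_sqrt hn'.le]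
      nlinarith) n
  have hfun : ∀ ω, |empProc Q z n f ω| / (2 * d)
      = |∑ i ∈ Finset.range n, (f (z i ω) - μ) / a| := fun ω => by
    rw [← Finset.sum_div, empProc, abs_mul, abs_div, abs_of_pos hapos,
      abs_of_pos (inv_pos.2 hsn), ha, ← hμ]
    field_simp
  simp only [hfun]
  refine key.trans_eq ?_
  congr 3
  field_simp

end EmpiricalProcess

/-! ### Truncation and the maximal inequality for Lipschitz classes -/

namespace EmpiricalProcess

variable {Ω Z : Type*} [MeasurableSpace Z] {Q : Measure Z} {z : ℕ → Ω → Z} {L : Z → ℝ}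

/-- The truncated second moment `E L² 1{L > √n}`. -/
noncomputable def tailSq (Q : Measure Z) (L : Z → ℝ) (n : ℕ) : ℝ :=
  ∫ x in {x | √(n : ℝ) < L x}, L x ^ 2 ∂Q

lemma tailSq_nonneg (Q : Measure Z) (L : Z → ℝ) (n : ℕ) : 0 ≤ tailSq Q L n :=
  integral_nonneg fun _ => sq_nonneg _

lemma tendsto_tailSq (hLm : Measurable L) (hL2 : Integrable (fun x => L x ^ 2) Q) :
    Tendsto (tailSq Q L) atTop (𝓝 0) := by
  have h := tendsto_setIntegral_of_antitone (μ := Q) (f := fun x => L x ^ 2)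
    (s := fun n : ℕ => {x | √(n : ℝ) < L x})
    (fun n => measurableSet_lt measurable_const hLm)
    (fun a b hab x (hx : √(b : ℝ) < L x) =>
      (Real.sqrt_le_sqrt (by exact_mod_cast hab)).trans_lt hx) ⟨0, hL2.integrableOn⟩
  have hempty : (⋂ n : ℕ, {x | √(n : ℝ) < L x}) = ∅ := by
    refine Set.eq_empty_of_forall_notMem fun x hx => ?_
    have hx' : ∀ n : ℕ, √(n : ℝ) < L x := fun n => Set.mem_iInter.1 hx n
    obtain ⟨n, hn⟩ := exists_nat_ge (L x ^ 2)
    have h0 : 0 ≤ L x := (Real.sqrt_nonneg _).trans (hx' 0).le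
    exact absurd (hx' n) (not_lt.2 (Real.le_sqrt_of_sq_le hn))
  rw [hempty, setIntegral_empty] at h
  exact h

/-- A crude bound growing with `n`, used only for continuity of the paths at fixed `n`. -/
lemma abs_empProc_le [IsProbabilityMeasure Q] {n : ℕ} (hn : 0 < n) {f : Z → ℝ} {b : ℝ} (hf : ∀ x, |f x| ≤ b) (ω : Ω) :
    |empProc Q z n f ω| ≤ (√(n : ℝ))⁻¹ * (n * (2 * b)) := by
  rw [empProc, abs_mul, abs_of_nonneg (by positivity)]
  gcongr
  have hμ : |∫ x, f x ∂Q| ≤ b := by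
    have := norm_integral_le_of_norm_le_const (μ := Q) (f := f) (C := b)
      (Eventually.of_forall hf)
    simpa using this
  refine (Finset.abs_sum_le_sum_abs _ _).trans ?_
  refine (Finset.sum_le_card_nsmul _ _ (2 * b) fun i _ => ?_).trans_eq (by simp)
  exact (abs_sub _ _).trans (by linarith [hf (z i ω)])

variable [MeasurableSpace Ω] {P : Measure Ω}

/-- Union bound over the `n` observations, then Markov on the tail: `n ≤ L²` where `L > √n`. This is
where square integrability of `L` matches the truncation level. -/
lemma meas_exists_sqrt_lt_le [IsFiniteMeasure Q] (hlaw : ∀ i, HasLaw (z i) Q P) (hLm : Measurable L)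
    (hL2 : Integrable (fun x => L x ^ 2) Q) (n : ℕ) :
    P {ω | ¬ ∀ i < n, L (z i ω) ≤ √(n : ℝ)} ≤ ENNReal.ofReal (tailSq Q L n) := by
  have hS : MeasurableSet {x | √(n : ℝ) < L x} := measurableSet_lt measurable_const hLm
  have hsub : {ω | ¬ ∀ i < n, L (z i ω) ≤ √(n : ℝ)}
      ⊆ ⋃ i ∈ Finset.range n, {ω | √(n : ℝ) < L (z i ω)} := fun ω hω => by
    simpa using hω
  have hone : ∀ i, P {ω | √(n : ℝ) < L (z i ω)} = Q {x | √(n : ℝ) < L x} :=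
    fun i => (hlaw i).measure_eq hS
  calc _ ≤ ∑ i ∈ Finset.range n, P {ω | √(n : ℝ) < L (z i ω)} :=
        (measure_mono hsub).trans (measure_biUnion_finset_le _ _)
    _ = n * Q {x | √(n : ℝ) < L x} := by simp [hone]
    _ = ENNReal.ofReal (n * Q.real {x | √(n : ℝ) < L x}) := by
        rw [ENNReal.ofReal_mul (by positivity), ENNReal.ofReal_natCast, ofReal_measureReal]
    _ ≤ _ := by
        refine ENNReal.ofReal_le_ofReal ?_
        have h := setIntegral_mono_on (μ := Q) (f := fun _ => (n : ℝ)) (g := fun x => L x ^ 2)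
          (integrable_const _).integrableOn hL2.integrableOn hS fun x (hx : √(n : ℝ) < L x) => by
            rw [← Real.sq_sqrt (Nat.cast_nonneg (α := ℝ) n)]
            exact pow_le_pow_left₀ (Real.sqrt_nonneg _) hx.le 2
        rw [setIntegral_const, smul_eq_mul, mul_comm] at h
        exact h

variable [IsProbabilityMeasure P] [IsProbabilityMeasure Q]

/-- **Maximal inequality for Lipschitz classes.** If `g` is indexed by a ball of a
finite-dimensional space and Lipschitz in the index with square integrable constant `L`, then the
oscillation of the empirical process `𝔾ₙ g` off a finite net is controlled uniformly in `n`
and `g`, on the event where `L` is at most `√n` at the first `n` observations. -/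
theorem exists_modulus {E : Type*} [NormedAddCommGroup E] [NormedSpace ℝ E]
    [FiniteDimensional ℝ E] (hlaw : ∀ i, HasLaw (z i) Q P) (hindep : iIndepFun z P)
    (hLm : Measurable L) (hL0 : ∀ x, 0 ≤ L x) (hL2 : Integrable (fun x => L x ^ 2) Q) :
    ∃ (T : ℕ → Finset E) (ε : ℕ → ℝ≥0∞), T 0 = {0} ∧ (∀ j, ∀ t ∈ T j, ‖t‖ ≤ 2) ∧
      (∀ j, ε j ≠ ⊤) ∧ Tendsto ε atTop (𝓝 0) ∧
      ∀ n : ℕ, 0 < n → ∀ g : Z → E → ℝ,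
        (∀ t, ‖t‖ ≤ 2 → AEStronglyMeasurable (fun x => g x t) Q) → (∀ x, g x 0 = 0) →
        (∀ x s t, ‖s‖ ≤ 2 → ‖t‖ ≤ 2 → |g x s - g x t| ≤ L x * ‖s - t‖) →
        ∀ J, ∃ D : Ω → ℝ≥0∞, AEMeasurable D P ∧ ∫⁻ ω, D ω ∂P ≤ ε J ∧
          ∀ ω, (∀ i < n, L (z i ω) ≤ √(n : ℝ)) → ∀ s, ‖s‖ ≤ 1 → ∃ t ∈ T J,
            ENNReal.ofReal |empProc Q z n (fun x => g x s) ω - empProc Q z n (fun x => g x t) ω|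
              ≤ D ω + ENNReal.ofReal (tailSq Q L n) := by
  set V := ∫ x, L x ^ 2 ∂Q with hV
  obtain ⟨T, ε, hT0, hT2, hεf, hε, hchain⟩ :=
    Chaining.exists_bound (E := E) P (2 * Real.exp (V / 4))
  refine ⟨T, fun J => 2 * ε J, hT0, hT2, fun J => ENNReal.mul_ne_top (by simp) (hεf J), ?_, ?_⟩
  · simpa using ENNReal.Tendsto.const_mul hε (Or.inr (by simp : (2 : ℝ≥0∞) ≠ ⊤))
  intro n hn g hgm hg0 hgL J
  have hn' : (0 : ℝ) < n := by exact_mod_cast hn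
  have hsn : 0 < √(n : ℝ) := Real.sqrt_pos.2 hn'
  have hL1 : Integrable L Q :=
    ((memLp_two_iff_integrable_sq hLm.aestronglyMeasurable).2 hL2).integrable one_le_two
  have hgint : ∀ t, ‖t‖ ≤ 2 → Integrable (fun x => g x t) Q := fun t ht =>
    (hL1.mul_const 2).mono' (hgm t ht) (Eventually.of_forall fun x => by
      have := hgL x t 0 ht (by simp)
      rw [hg0, sub_zero, sub_zero] at this
      exact this.trans (mul_le_mul_of_nonneg_left ht (hL0 x)))
  -- Truncating makes the increments at most `‖s - t‖√n`, the size required for exponential moments,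
  -- and keeps the Lipschitz constant `L`.
  set A : Set Z := {x | L x ≤ √(n : ℝ)} with hA
  have hAm : MeasurableSet A := measurableSet_le hLm measurable_const
  let h : E → Z → ℝ := fun t => A.indicator fun x => g x t
  have hhm : ∀ t, ‖t‖ ≤ 2 → AEStronglyMeasurable (h t) Q := fun t ht => (hgm t ht).indicator hAm
  have hhint : ∀ t, ‖t‖ ≤ 2 → Integrable (h t) Q := fun t ht => (hgint t ht).indicator hAm
  have hhL : ∀ s t, ‖s‖ ≤ 2 → ‖t‖ ≤ 2 → ∀ x, |h s x - h t x| ≤ L x * ‖s - t‖ := by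
    intro s t hs ht x
    by_cases hx : x ∈ A
    · simp only [h, Set.indicator_of_mem hx]; exact hgL x s t hs ht
    · simp only [h, Set.indicator_of_notMem hx, sub_zero, abs_zero]
      exact mul_nonneg (hL0 x) (norm_nonneg _)
  have hhn : ∀ s t, ‖s‖ ≤ 2 → ‖t‖ ≤ 2 → ∀ x, |h s x - h t x| ≤ ‖s - t‖ * √n := by
    intro s t hs ht x
    by_cases hx : x ∈ A
    · refine (hhL s t hs ht x).trans ?_
      rw [mul_comm]
      exact mul_le_mul_of_nonneg_left hx (norm_nonneg _)
    · simp only [h, Set.indicator_of_notMem hx, sub_zero, abs_zero]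
      positivity
  have hsub : ∀ s t, ‖s‖ ≤ 2 → ‖t‖ ≤ 2 → ∀ ω, empProc Q z n (h s) ω - empProc Q z n (h t) ω
      = empProc Q z n (fun x => h s x - h t x) ω := fun s t hs ht ω =>
    (empProc_sub n (hhint s hs) (hhint t ht) ω).symm
  -- Halving the process absorbs the `2d` in the exponential moment bound; it is undone by `2 * D`
  -- below.
  obtain ⟨D, hDm, hDint, hD⟩ := hchain (fun t ω => empProc Q z n (h t) ω / 2)
    (fun t ht => (aemeasurable_empProc hlaw n (hhm t ht)).div_const _)
    (fun ω => by
      have hlip : LipschitzOnWith (Real.toNNReal ((√(n : ℝ))⁻¹ * (n * (2 * √n)) / 2))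
          (fun t => empProc Q z n (h t) ω / 2) (Metric.closedBall 0 2) := by
        refine LipschitzOnWith.of_dist_le' fun s hs t ht => ?_
        rw [mem_closedBall_zero_iff] at hs ht
        rw [Real.dist_eq, dist_eq_norm, ← sub_div, hsub s t hs ht, abs_div, abs_two]
        have := abs_empProc_le (Q := Q) (z := z) hn (hhn s t hs ht) ω
        calc _ ≤ (√(n : ℝ))⁻¹ * (n * (2 * (‖s - t‖ * √n))) / 2 := by gcongr
          _ = _ := by ring
      exact hlip.continuousOn)
    (fun s t d hs ht hd hst => by
      have := lintegral_exp_abs_empProc_le hlaw hindep hn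
        (f := fun x => h s x - h t x) ((hhm s hs).sub (hhm t ht)) (V := V) hd
        (fun x => (hhn s t hs ht x).trans (by gcongr)) (by
          rw [hV, ← integral_const_mul]
          refine integral_mono_of_nonneg (Eventually.of_forall fun _ => sq_nonneg _)
            (hL2.const_mul _) (Eventually.of_forall fun x => ?_)
          simp only
          rw [← mul_pow, ← sq_abs (h s x - h t x), mul_comm d]
          gcongr
          exact (hhL s t hs ht x).trans (mul_le_mul_of_nonneg_left hst (hL0 x)))
      refine le_of_eq_of_le ?_ this
      refine lintegral_congr fun ω => ?_
      rw [← sub_div, hsub s t hs ht, abs_div, abs_two, div_div]) J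
  refine ⟨fun ω => 2 * D ω, hDm.const_mul _, ?_, fun ω hω s hs => ?_⟩
  · rw [lintegral_const_mul'' _ hDm]
    exact mul_le_mul_right hDint 2
  obtain ⟨t, htT, hst, htD⟩ := hD ω s hs
  refine ⟨t, htT, ?_⟩
  have ht2 := hT2 J t htT
  have hs2 : ‖s‖ ≤ 2 := hs.trans one_le_two
  have hAω : ∀ i ∈ Finset.range n, z i ω ∈ A := fun i hi => hω i (Finset.mem_range.1 hi)
  -- On the good event truncation changes no summand, only the mean. The change is `√n` times an
  -- integral over `{L > √n}`, where `√n L ≤ L²`; here `‖s - t‖ ≤ 1` is used.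
  have hdiff : |empProc Q z n (fun x => g x s) ω - empProc Q z n (fun x => g x t) ω
      - (empProc Q z n (h s) ω - empProc Q z n (h t) ω)| ≤ tailSq Q L n := by
    rw [← empProc_sub n (hgint s hs2) (hgint t ht2), hsub s t hs2 ht2,
      ← empProc_sub (f := fun x => g x s - g x t) (g := fun x => h s x - h t x) n
        ((hgint s hs2).sub (hgint t ht2)) ((hhint s hs2).sub (hhint t ht2))]
    set k : Z → ℝ := fun x => g x s - g x t - (h s x - h t x) with hk
    have hk_ind : k = Aᶜ.indicator fun x => g x s - g x t := by
      funext x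
      by_cases hx : x ∈ A
      · simp [hk, h, hx]
      · simp [hk, h, hx]
    have hk0 : ∀ i ∈ Finset.range n, k (z i ω) = 0 := fun i hi => by
      rw [hk_ind, Set.indicator_of_notMem (by simpa using hAω i hi)]
    have hAc : Aᶜ = {x | √(n : ℝ) < L x} := by ext x; simp [hA]
    have hkint : |∫ x, k x ∂Q| ≤ (√(n : ℝ))⁻¹ * tailSq Q L n := by
      rw [hk_ind, integral_indicator hAm.compl, hAc, tailSq, ← integral_const_mul,
        ← Real.norm_eq_abs]
      refine norm_integral_le_of_norm_le ((hL2.const_mul _).integrableOn) ?_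
      refine (ae_restrict_iff' (hAc ▸ hAm.compl)).2 (Eventually.of_forall fun x hx => ?_)
      have hx' : √(n : ℝ) < L x := hx
      rw [Real.norm_eq_abs, le_inv_mul_iff₀ hsn, sq]
      calc √(n : ℝ) * |g x s - g x t| ≤ √(n : ℝ) * (L x * ‖s - t‖) := by
            gcongr; exact hgL x s t hs2 ht2
        _ ≤ L x * (L x * 1) := by
            have := hL0 x
            gcongr
        _ = L x * L x := by ring
    rw [empProc, Finset.sum_congr rfl fun i hi => by rw [hk0 i hi]]
    rw [Finset.sum_const, Finset.card_range, nsmul_eq_mul, zero_sub, abs_mul, abs_mul, abs_neg,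
      abs_of_pos hn', abs_of_pos (inv_pos.2 hsn)]
    calc (√(n : ℝ))⁻¹ * (n * |∫ x, k x ∂Q|)
        ≤ (√(n : ℝ))⁻¹ * (n * ((√(n : ℝ))⁻¹ * tailSq Q L n)) := by gcongr
      _ = tailSq Q L n := by
        nth_rewrite 2 [← Real.mul_self_sqrt hn'.le]
        field_simp
  have h1 : ENNReal.ofReal |empProc Q z n (h s) ω - empProc Q z n (h t) ω| ≤ 2 * D ω := by
    calc _ = 2 * ENNReal.ofReal |empProc Q z n (h s) ω / 2 - empProc Q z n (h t) ω / 2| := by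
          rw [← sub_div, abs_div, abs_two, ← ENNReal.ofReal_ofNat 2,
            ← ENNReal.ofReal_mul zero_le_two, mul_div_cancel₀ _ two_ne_zero]
      _ ≤ _ := by gcongr
  refine le_trans (ENNReal.ofReal_le_ofReal ?_) (ENNReal.ofReal_add_le.trans
    (add_le_add h1 (ENNReal.ofReal_le_ofReal hdiff)))
  have := abs_add_le (empProc Q z n (h s) ω - empProc Q z n (h t) ω)
    (empProc Q z n (fun x => g x s) ω - empProc Q z n (fun x => g x t) ω
      - (empProc Q z n (h s) ω - empProc Q z n (h t) ω))
  rwa [add_sub_cancel] at this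

end EmpiricalProcess

/-! ### Local fluctuations of a Lipschitz criterion -/

namespace MEstimation

open EmpiricalProcess

lemma norm_add_smul_sub_le {E : Type*} [NormedAddCommGroup E] [NormedSpace ℝ E] {θ₀ : E} {a R : ℝ}
    (ha : 0 ≤ a) (haR : 2 * a ≤ R) {s : E} (hs : ‖s‖ ≤ 2) : ‖θ₀ + a • s - θ₀‖ ≤ R := by
  rw [add_sub_cancel_left, norm_smul, Real.norm_of_nonneg ha]
  nlinarith

variable {Ω Z E : Type*} [MeasurableSpace Z] [NormedAddCommGroup E] [InnerProductSpace ℝ E]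
  [CompleteSpace E]

/-- Local regularity of a criterion `m` at `θ₀`: on the ball of radius `R` it is integrable and
Lipschitz with square integrable constant `L`, and at `θ₀` it has gradient `ψ`. -/
structure LocallyLipschitz (Q : Measure Z) (m : Z → E → ℝ) (θ₀ : E) (R : ℝ) (L : Z → ℝ)
    (ψ : Z → E) : Prop where
  radius_pos : 0 < R
  measurable_const : Measurable L
  const_nonneg : ∀ x, 0 ≤ L x
  integrable_sq : Integrable (fun x => L x ^ 2) Q
  integrable : ∀ θ, ‖θ - θ₀‖ ≤ R → Integrable (fun x => m x θ) Q
  lipschitz : ∀ x θ θ', ‖θ - θ₀‖ ≤ R → ‖θ' - θ₀‖ ≤ R → |m x θ - m x θ'| ≤ L x * ‖θ - θ'‖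
  hasGradientAt : ∀ x, HasGradientAt (m x) (ψ x) θ₀
  measurable_grad : AEStronglyMeasurable ψ Q
  norm_grad_le : ∀ x, ‖ψ x‖ ≤ L x

namespace LocallyLipschitz

variable {Q : Measure Z} {m : Z → E → ℝ} {θ₀ : E} {R : ℝ} {L : Z → ℝ} {ψ : Z → E}
  (hm : LocallyLipschitz Q m θ₀ R L ψ)
include hm

lemma integrable_const [IsFiniteMeasure Q] : Integrable L Q :=
  ((memLp_two_iff_integrable_sq hm.measurable_const.aestronglyMeasurable).2
    hm.integrable_sq).integrable one_le_two

lemma integrable_grad [IsFiniteMeasure Q] : Integrable ψ Q :=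
  hm.integrable_const.mono' hm.measurable_grad (Eventually.of_forall hm.norm_grad_le)

/-- The population criterion is stationary at a maximizer. -/
lemma integral_grad_eq_zero [IsFiniteMeasure Q]
    (hmax : ∀ θ, ‖θ - θ₀‖ ≤ R → ∫ x, m x θ ∂Q ≤ ∫ x, m x θ₀ ∂Q) : ∫ x, ψ x ∂Q = 0 := by
  have hball : ∀ᶠ θ in 𝓝 θ₀, ‖θ - θ₀‖ ≤ R := by
    filter_upwards [Metric.closedBall_mem_nhds θ₀ hm.radius_pos] with θ hθ
    rwa [mem_closedBall_iff_norm] at hθ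
  have hψ : Integrable (fun x => InnerProductSpace.toDual ℝ E (ψ x)) Q :=
    (InnerProductSpace.toDual ℝ E).toContinuousLinearEquiv.toContinuousLinearMap.integrable_comp
      hm.integrable_grad
  -- Differentiation under the integral, dominated by the Lipschitz constant; Fermat's rule then
  -- applies.
  have hd := hasFDerivAt_integral_of_dominated_loc_of_lip (μ := Q) (𝕜 := ℝ)
    (F := fun θ x => m x θ) (x₀ := θ₀) (s := Metric.closedBall θ₀ R) (bound := L)
    (F' := fun x => InnerProductSpace.toDual ℝ E (ψ x))
    (Metric.closedBall_mem_nhds θ₀ hm.radius_pos)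
    (hball.mono fun θ hθ => (hm.integrable θ hθ).aestronglyMeasurable)
    (hm.integrable θ₀ (by simpa using hm.radius_pos.le)) hψ.aestronglyMeasurable
    (Eventually.of_forall fun x => LipschitzOnWith.of_dist_le_mul fun θ hθ θ' hθ' => by
      rw [mem_closedBall_iff_norm] at hθ hθ'
      rw [Real.dist_eq, dist_eq_norm, Real.coe_nnabs, abs_of_nonneg (hm.const_nonneg x)]
      exact hm.lipschitz x θ θ' hθ hθ')
    hm.integrable_const (Eventually.of_forall fun x => (hm.hasGradientAt x).hasFDerivAt)
  have hz := IsLocalMax.hasFDerivAt_eq_zero (hball.mono hmax) hd.2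
  have hcomm : ∫ x, InnerProductSpace.toDual ℝ E (ψ x) ∂Q
      = InnerProductSpace.toDual ℝ E (∫ x, ψ x ∂Q) :=
    (InnerProductSpace.toDual ℝ E).toContinuousLinearEquiv.toContinuousLinearMap.integral_comp_comm
      hm.integrable_grad
  rw [hcomm] at hz
  simpa using hz

/-- The remainders of the first order expansion vanish in mean square. -/
lemma tendsto_integral_sq_remainder [IsFiniteMeasure Q] {a : ℕ → ℝ} (ha : ∀ᶠ n in atTop, 0 < a n)
    (ha0 : Tendsto a atTop (𝓝 0)) {t : E} (ht : ‖t‖ ≤ 2) :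
    Tendsto (fun n => ∫ x, ((a n)⁻¹ * (m x (θ₀ + a n • t) - m x θ₀) - inner ℝ (ψ x) t) ^ 2 ∂Q)
      atTop (𝓝 0) := by
  have haR : ∀ᶠ n in atTop, 2 * a n ≤ R := by
    have h2 : Tendsto (fun n => 2 * a n) atTop (𝓝 0) := by simpa using ha0.const_mul 2
    exact (h2.eventually_lt_const hm.radius_pos).mono fun _ h => h.le
  have hθ₀ : ‖θ₀ - θ₀‖ ≤ R := by simpa using hm.radius_pos.le
  -- For `‖t‖ ≤ 2` the difference quotient and the linear term are each at most `2L`, hence the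
  -- dominating function `(4L)²`.
  have h := tendsto_integral_filter_of_dominated_convergence (μ := Q) (l := atTop)
    (F := fun n x => ((a n)⁻¹ * (m x (θ₀ + a n • t) - m x θ₀) - inner ℝ (ψ x) t) ^ 2)
    (f := fun _ => 0) (fun x => 16 * L x ^ 2) ?_ ?_ (hm.integrable_sq.const_mul 16) ?_
  · simpa using h
  · filter_upwards [ha, haR] with n hn hnR
    exact ((((hm.integrable _ (norm_add_smul_sub_le hn.le hnR ht)).aestronglyMeasurable.sub
      (hm.integrable _ hθ₀).aestronglyMeasurable).const_mul _).sub
      (hm.measurable_grad.inner aestronglyMeasurable_const)).pow 2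
  · filter_upwards [ha, haR] with n hn hnR
    refine Eventually.of_forall fun x => ?_
    have hL := hm.const_nonneg x
    have h1 : |(a n)⁻¹ * (m x (θ₀ + a n • t) - m x θ₀)| ≤ 2 * L x := by
      rw [abs_mul, abs_of_pos (inv_pos.2 hn), inv_mul_le_iff₀ hn]
      refine (hm.lipschitz x _ _ (norm_add_smul_sub_le hn.le hnR ht) hθ₀).trans ?_
      rw [add_sub_cancel_left, norm_smul, Real.norm_of_nonneg hn.le]
      nlinarith [mul_nonneg hL hn.le]
    have h2 : |inner ℝ (ψ x) t| ≤ 2 * L x := by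
      refine (abs_real_inner_le_norm _ _).trans ?_
      nlinarith [hm.norm_grad_le x, norm_nonneg (ψ x), norm_nonneg t]
    rw [Real.norm_eq_abs, abs_pow, show 16 * L x ^ 2 = (4 * L x) ^ 2 by ring]
    refine pow_le_pow_left₀ (abs_nonneg _) ((abs_sub _ _).trans ?_) 2
    linarith
  · refine Eventually.of_forall fun x => ?_
    have hg : HasDerivAt (fun b : ℝ => m x (θ₀ + b • t)) (inner ℝ (ψ x) t) 0 := by
      have h1 : HasDerivAt (fun b : ℝ => θ₀ + b • t) t 0 := by
        simpa using ((hasDerivAt_id (0 : ℝ)).smul_const t).const_add θ₀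
      have h2 : HasFDerivAt (m x) (InnerProductSpace.toDual ℝ E (ψ x)) (θ₀ + (0 : ℝ) • t) := by
        simpa using (hm.hasGradientAt x).hasFDerivAt
      have h3 := h2.comp_hasDerivAt (0 : ℝ) h1
      rwa [InnerProductSpace.toDual_apply_apply] at h3
    have hs := hg.tendsto_slope_zero
    have ha' : Tendsto a atTop (𝓝[≠] 0) :=
      tendsto_nhdsWithin_iff.2 ⟨ha0, ha.mono fun n hn => hn.ne'⟩
    have := ((hs.comp ha').sub_const (inner ℝ (ψ x) t)).pow 2
    simpa using this

variable [MeasurableSpace Ω] [FiniteDimensional ℝ E] {P : Measure Ω} [IsProbabilityMeasure P]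
  [IsProbabilityMeasure Q] {z : ℕ → Ω → Z}

/-- Local maximal inequality for the criterion increments. -/
lemma exists_local_bound (hlaw : ∀ i, HasLaw (z i) Q P) (hindep : iIndepFun z P) :
    ∃ K : ℝ≥0∞, K ≠ ⊤ ∧ ∀ n : ℕ, 0 < n → ∀ r : ℝ, 0 < r → 2 * r ≤ R →
      ∃ D : Ω → ℝ≥0∞, AEMeasurable D P ∧ ∫⁻ ω, D ω ∂P ≤ K ∧
        ∀ ω, (∀ i < n, L (z i ω) ≤ √(n : ℝ)) → ∀ θ, ‖θ - θ₀‖ ≤ r →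
          ENNReal.ofReal |empProc Q z n (fun x => m x θ - m x θ₀) ω|
            ≤ ENNReal.ofReal r * (D ω + ENNReal.ofReal (tailSq Q L n)) := by
  obtain ⟨T, ε, hT0, -, hεf, -, hb⟩ := exists_modulus (E := E) hlaw hindep hm.measurable_const
    hm.const_nonneg hm.integrable_sq
  refine ⟨ε 0, hεf 0, fun n hn r hr hrR => ?_⟩
  have hθ₀ : ‖θ₀ - θ₀‖ ≤ R := by simpa using hm.radius_pos.le
  -- Rescaling the ball of radius `r` to the unit ball and dividing by `r` keeps the Lipschitz
  -- constant `L`, so the bound is uniform in `r`. At level `0` the net is `{0}`, where the class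
  -- vanishes: the oscillation is the process itself.
  obtain ⟨D, hDm, hDint, hD⟩ := hb n hn (fun x s => r⁻¹ * (m x (θ₀ + r • s) - m x θ₀))
    (fun t ht => ((hm.integrable _ (norm_add_smul_sub_le hr.le hrR ht)).aestronglyMeasurable.sub
      (hm.integrable _ hθ₀).aestronglyMeasurable).const_mul _)
    (fun x => by simp)
    (fun x s t hs ht => by
      rw [← mul_sub, sub_sub_sub_cancel_right, abs_mul, abs_of_pos (inv_pos.2 hr),
        inv_mul_le_iff₀ hr]
      refine (hm.lipschitz x _ _ (norm_add_smul_sub_le hr.le hrR hs)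
        (norm_add_smul_sub_le hr.le hrR ht)).trans_eq ?_
      rw [add_sub_add_left_eq_sub, ← smul_sub, norm_smul, Real.norm_of_nonneg hr.le]
      ring) 0
  refine ⟨D, hDm, hDint, fun ω hω θ hθ => ?_⟩
  obtain ⟨t, ht, hst⟩ := hD ω hω (r⁻¹ • (θ - θ₀)) (by
    rw [norm_smul, Real.norm_of_nonneg (by positivity), inv_mul_le_iff₀ hr, mul_one]
    exact hθ)
  rw [hT0, Finset.mem_singleton] at ht
  subst ht
  simp only [smul_smul, mul_inv_cancel₀ hr.ne', one_smul, add_sub_cancel, smul_zero, add_zero,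
    sub_self, mul_zero] at hst
  rw [empProc_const_mul] at hst
  have h0 : empProc Q z n (fun _ => 0) ω = 0 := by simp [empProc]
  rw [h0, sub_zero, abs_mul, abs_of_pos (inv_pos.2 hr)] at hst
  calc ENNReal.ofReal |empProc Q z n (fun x => m x θ - m x θ₀) ω|
      = ENNReal.ofReal r
          * ENNReal.ofReal (r⁻¹ * |empProc Q z n (fun x => m x θ - m x θ₀) ω|) := by
        rw [← ENNReal.ofReal_mul hr.le, mul_inv_cancel_left₀ hr.ne']
    _ ≤ _ := by gcongr

/-- Tightness of the normalized score. -/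
lemma exists_score_bound (hlaw : ∀ i, HasLaw (z i) Q P) (hindep : iIndepFun z P) :
    ∃ K : ℝ≥0∞, K ≠ ⊤ ∧ ∀ n : ℕ, 0 < n →
      ∃ D : Ω → ℝ≥0∞, AEMeasurable D P ∧ ∫⁻ ω, D ω ∂P ≤ K ∧
        ∀ ω, (∀ i < n, L (z i ω) ≤ √(n : ℝ)) → ∀ s : E, ‖s‖ ≤ 1 →
          ENNReal.ofReal |empProc Q z n (fun x => inner ℝ (ψ x) s) ω|
            ≤ D ω + ENNReal.ofReal (tailSq Q L n) := by
  obtain ⟨T, ε, hT0, -, hεf, -, hb⟩ := exists_modulus (E := E) hlaw hindep hm.measurable_const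
    hm.const_nonneg hm.integrable_sq
  refine ⟨ε 0, hεf 0, fun n hn => ?_⟩
  obtain ⟨D, hDm, hDint, hD⟩ := hb n hn (fun x s => inner ℝ (ψ x) s)
    (fun t _ => hm.measurable_grad.inner aestronglyMeasurable_const)
    (fun x => by simp)
    (fun x s t hs ht => by
      rw [← inner_sub_right]
      exact (abs_real_inner_le_norm _ _).trans
        (mul_le_mul_of_nonneg_right (hm.norm_grad_le x) (norm_nonneg _))) 0
  refine ⟨D, hDm, hDint, fun ω hω s hs => ?_⟩
  obtain ⟨t, ht, hst⟩ := hD ω hω s hs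
  rw [hT0, Finset.mem_singleton] at ht
  subst ht
  simpa [empProc] using hst

/-- Uniform first-order expansion of the empirical process on `n^{-1/2}`-neighbourhoods. -/
theorem tendsto_sup_remainder (hlaw : ∀ i, HasLaw (z i) Q P) (hindep : iIndepFun z P)
    {C ε : ℝ} (hC : 0 < C) (hε : 0 < ε) :
    Tendsto (fun n : ℕ => P {ω | ∃ h : E, ‖h‖ ≤ C ∧
      ε ≤ |√n * empProc Q z n (fun x => m x (θ₀ + (√(n : ℝ))⁻¹ • h) - m x θ₀) ω
        - empProc Q z n (fun x => inner ℝ (ψ x) h) ω|}) atTop (𝓝 0) := by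
  -- The remainder is Lipschitz with constant `2L`: one `L` from the difference quotient, one from
  -- the gradient.
  have hL2' : Integrable (fun x => (2 * L x) ^ 2) Q := by
    simpa only [mul_pow] using hm.integrable_sq.const_mul (2 ^ 2)
  have hLm' : Measurable fun x => 2 * L x := hm.measurable_const.const_mul 2
  obtain ⟨T, e, hT0, hT2, hef, he, hb⟩ := exists_modulus (E := E) hlaw hindep hLm'
    (fun x => mul_nonneg zero_le_two (hm.const_nonneg x)) hL2'
  have hθ₀ : ‖θ₀ - θ₀‖ ≤ R := by simpa using hm.radius_pos.le
  -- With `h = C s` the shift `h/√n` is `a n • s`, so `s` runs over the unit ball.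
  set a : ℕ → ℝ := fun n => C * (√(n : ℝ))⁻¹ with ha_def
  have ha : ∀ᶠ n in atTop, 0 < a n := by
    filter_upwards [eventually_gt_atTop 0] with n hn
    have : 0 < √(n : ℝ) := Real.sqrt_pos.2 (by exact_mod_cast hn)
    positivity
  have ha0 : Tendsto a atTop (𝓝 0) := by
    simpa using (tendsto_inv_atTop_zero.comp
      (Real.tendsto_sqrt_atTop.comp tendsto_natCast_atTop_atTop)).const_mul C
  have haR : ∀ᶠ n in atTop, 2 * a n ≤ R := by
    have h2 : Tendsto (fun n => 2 * a n) atTop (𝓝 0) := by simpa using ha0.const_mul 2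
    exact (h2.eventually_lt_const hm.radius_pos).mono fun _ h => h.le
  let g : ℕ → Z → E → ℝ := fun n x s =>
    (a n)⁻¹ * (m x (θ₀ + a n • s) - m x θ₀) - inner ℝ (ψ x) s
  have hgm : ∀ n, 0 < a n → 2 * a n ≤ R → ∀ t : E, ‖t‖ ≤ 2 →
      AEStronglyMeasurable (fun x => g n x t) Q := fun n hn hnR t ht =>
    (((hm.integrable _ (norm_add_smul_sub_le hn.le hnR ht)).aestronglyMeasurable.sub
      (hm.integrable _ hθ₀).aestronglyMeasurable).const_mul _).sub
      (hm.measurable_grad.inner aestronglyMeasurable_const)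
  have hg0 : ∀ n x, g n x 0 = 0 := fun n x => by simp [g]
  have hgL : ∀ n, 0 < a n → 2 * a n ≤ R → ∀ x (s t : E), ‖s‖ ≤ 2 → ‖t‖ ≤ 2 →
      |g n x s - g n x t| ≤ 2 * L x * ‖s - t‖ := by
    intro n hn hnR x s t hs ht
    have h1 : |(a n)⁻¹ * (m x (θ₀ + a n • s) - m x (θ₀ + a n • t))| ≤ L x * ‖s - t‖ := by
      rw [abs_mul, abs_of_pos (inv_pos.2 hn), inv_mul_le_iff₀ hn]
      refine (hm.lipschitz x _ _ (norm_add_smul_sub_le hn.le hnR hs)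
        (norm_add_smul_sub_le hn.le hnR ht)).trans_eq ?_
      rw [add_sub_add_left_eq_sub, ← smul_sub, norm_smul, Real.norm_of_nonneg hn.le]
      ring
    have h2 : |inner ℝ (ψ x) (s - t)| ≤ L x * ‖s - t‖ := (abs_real_inner_le_norm _ _).trans
      (mul_le_mul_of_nonneg_right (hm.norm_grad_le x) (norm_nonneg _))
    have h3 : g n x s - g n x t = (a n)⁻¹ * (m x (θ₀ + a n • s) - m x (θ₀ + a n • t))
        - inner ℝ (ψ x) (s - t) := by
      simp only [g, inner_sub_right]; ring
    rw [h3]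
    exact (abs_sub _ _).trans (by linarith)
  -- Contributions below `κ` come from `D`, from the truncation tail and from the net point; their
  -- sum times `C` stays below `4κC = ε`.
  set κ := ε / (4 * C) with hκ
  have hκ0 : 0 < κ := by positivity
  rw [ENNReal.tendsto_nhds_zero]
  intro η hη
  have hη3 : 0 < η / 3 := ENNReal.div_pos hη.ne' (by simp)
  -- The net level is fixed before `n`, so only finitely many net points are left as `n` grows.
  obtain ⟨J, hJ⟩ : ∃ J, e J / ENNReal.ofReal κ ≤ η / 3 := by
    have h1 : Tendsto (fun J => e J / ENNReal.ofReal κ) atTop (𝓝 0) := by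
      simpa using ENNReal.Tendsto.div_const he (Or.inr (by simpa using hκ0))
    exact ((ENNReal.tendsto_nhds_zero.1 h1) _ hη3).exists
  have hbad : ∀ᶠ n in atTop, ENNReal.ofReal (tailSq Q (fun x => 2 * L x) n) ≤ η / 3 := by
    have h1 := ENNReal.tendsto_ofReal (tendsto_tailSq hLm' hL2')
    rw [ENNReal.ofReal_zero] at h1
    exact (ENNReal.tendsto_nhds_zero.1 h1) _ hη3
  have htail : ∀ᶠ n in atTop, tailSq Q (fun x => 2 * L x) n < κ :=
    (tendsto_tailSq hLm' hL2').eventually_lt_const hκ0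
  have hnet : ∀ᶠ n in atTop,
      ∑ t ∈ T J, ENNReal.ofReal ((∫ x, g n x t ^ 2 ∂Q) / κ ^ 2) ≤ η / 3 := by
    have h1 : Tendsto (fun n => ∑ t ∈ T J, ENNReal.ofReal ((∫ x, g n x t ^ 2 ∂Q) / κ ^ 2))
        atTop (𝓝 0) := by
      have : (0 : ℝ≥0∞) = ∑ t ∈ T J, ENNReal.ofReal (0 / κ ^ 2) := by simp
      rw [this]
      refine tendsto_finsetSum _ fun t ht => ENNReal.tendsto_ofReal (Tendsto.div_const ?_ _)
      exact hm.tendsto_integral_sq_remainder ha ha0 (hT2 J t ht)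
    exact (ENNReal.tendsto_nhds_zero.1 h1) _ hη3
  filter_upwards [ha, haR, hbad, htail, hnet, eventually_gt_atTop 0] with n hn hnR hbad htail hnet
    hn0
  obtain ⟨D, hDm, hDint, hD⟩ := hb n hn0 (g n) (hgm n hn hnR) (hg0 n) (hgL n hn hnR) J
  have hsn : 0 < √(n : ℝ) := Real.sqrt_pos.2 (by exact_mod_cast hn0)
  have hgLp : ∀ t : E, ‖t‖ ≤ 2 → MemLp (fun x => g n x t) 2 Q := fun t ht => by
    rw [memLp_two_iff_integrable_sq (hgm n hn hnR t ht)]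
    refine (hL2'.const_mul 4).mono' ((hgm n hn hnR t ht).pow 2) (Eventually.of_forall fun x => ?_)
    have h1 := hgL n hn hnR x t 0 ht (by simp)
    rw [hg0, sub_zero, sub_zero] at h1
    have hL := hm.const_nonneg x
    rw [Real.norm_eq_abs, abs_pow, show 4 * (2 * L x) ^ 2 = (2 * L x * 2) ^ 2 by ring]
    refine pow_le_pow_left₀ (abs_nonneg _) (h1.trans ?_) 2
    gcongr
  have hincl : {ω | ∃ h : E, ‖h‖ ≤ C ∧
      ε ≤ |√n * empProc Q z n (fun x => m x (θ₀ + (√(n : ℝ))⁻¹ • h) - m x θ₀) ω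
        - empProc Q z n (fun x => inner ℝ (ψ x) h) ω|}
      ⊆ ({ω | ¬ ∀ i < n, 2 * L (z i ω) ≤ √(n : ℝ)} ∪ {ω | ENNReal.ofReal κ ≤ D ω})
        ∪ ⋃ t ∈ T J, {ω | κ ≤ |empProc Q z n (fun x => g n x t) ω|} := by
    rintro ω ⟨h, hhC, hh⟩
    by_contra hcon
    simp only [Set.mem_union, Set.mem_iUnion, Set.mem_ofPred_eq, not_or, not_not, not_exists,
      not_le] at hcon
    obtain ⟨⟨hgood, hDω⟩, hT⟩ := hcon
    obtain ⟨t, ht, hst⟩ := hD ω hgood (C⁻¹ • h) (by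
      rw [norm_smul, Real.norm_of_nonneg (by positivity), inv_mul_le_iff₀ hC, mul_one]
      exact hhC)
    have h1 : |empProc Q z n (fun x => g n x (C⁻¹ • h)) ω
        - empProc Q z n (fun x => g n x t) ω| < κ + κ := by
      have h2 : D ω + ENNReal.ofReal (tailSq Q (fun x => 2 * L x) n)
          < ENNReal.ofReal κ + ENNReal.ofReal κ :=
        ENNReal.add_lt_add hDω ((ENNReal.ofReal_lt_ofReal_iff hκ0).2 htail)
      rw [← ENNReal.ofReal_add hκ0.le hκ0.le] at h2
      exact (ENNReal.ofReal_lt_ofReal_iff (by positivity)).1 (hst.trans_lt h2)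
    have h2 := hT t ht
    have hint1 : Integrable (fun x => m x (θ₀ + (√(n : ℝ))⁻¹ • h) - m x θ₀) Q := by
      refine (hm.integrable _ ?_).sub (hm.integrable _ hθ₀)
      rw [add_sub_cancel_left, norm_smul, Real.norm_of_nonneg (by positivity)]
      calc (√(n : ℝ))⁻¹ * ‖h‖ ≤ (√(n : ℝ))⁻¹ * C := by gcongr
        _ = a n := mul_comm _ _
        _ ≤ R := by linarith
    have h3 : C * empProc Q z n (fun x => g n x (C⁻¹ • h)) ω
        = √n * empProc Q z n (fun x => m x (θ₀ + (√(n : ℝ))⁻¹ • h) - m x θ₀) ω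
        - empProc Q z n (fun x => inner ℝ (ψ x) h) ω := by
      rw [← empProc_const_mul, ← empProc_const_mul n (√(n : ℝ)),
        ← empProc_sub n (hint1.const_mul _) (hm.integrable_grad.inner_const h)]
      congr 1
      funext x
      have h5 : a n • C⁻¹ • h = (√(n : ℝ))⁻¹ • h := by
        rw [smul_smul, ha_def]; congr 1; field_simp
      simp only [g]
      rw [h5, inner_smul_right, ha_def]
      field_simp
    rw [← h3, abs_mul, abs_of_pos hC] at hh
    have h4 : |empProc Q z n (fun x => g n x (C⁻¹ • h)) ω| < 4 * κ := by
      have := abs_sub_abs_le_abs_sub (empProc Q z n (fun x => g n x (C⁻¹ • h)) ω)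
        (empProc Q z n (fun x => g n x t) ω)
      linarith
    have : C * |empProc Q z n (fun x => g n x (C⁻¹ • h)) ω| < C * (4 * κ) :=
      mul_lt_mul_of_pos_left h4 hC
    have h6 : C * (4 * κ) = ε := by rw [hκ]; field_simp
    linarith
  calc P _ ≤ _ := measure_mono hincl
    _ ≤ η / 3 + η / 3 + η / 3 := by
      refine (measure_union_le _ _).trans (add_le_add ((measure_union_le _ _).trans
        (add_le_add ?_ ?_)) ?_)
      · exact (meas_exists_sqrt_lt_le hlaw hLm' hL2' n).trans hbad
      · refine (meas_ge_le_lintegral_div hDm (by simpa using hκ0) ENNReal.ofReal_ne_top).trans ?_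
        exact (ENNReal.div_le_div_right hDint _).trans hJ
      · refine (measure_biUnion_finset_le _ _).trans (le_trans ?_ hnet)
        exact Finset.sum_le_sum fun t ht =>
          meas_empProc_ge_le hlaw hindep hn0 (hgLp t (hT2 J t ht)) hκ0
    _ = η := ENNReal.add_thirds η

end LocallyLipschitz

end MEstimation

/-! ### Rate of convergence by peeling -/

namespace MEstimation

open EmpiricalProcess

variable {Ω Z E : Type*} [MeasurableSpace Z] [NormedAddCommGroup E] [InnerProductSpace ℝ E]
  [CompleteSpace E]

namespace LocallyLipschitz

variable {Q : Measure Z} {m : Z → E → ℝ} {θ₀ : E} {R : ℝ} {L : Z → ℝ} {ψ : Z → E}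
  (hm : LocallyLipschitz Q m θ₀ R L ψ)
include hm

lemma sum_sub_eq {z : ℕ → Ω → Z} {n : ℕ} (hn : 0 < n) {θ : E} (hθ : ‖θ - θ₀‖ ≤ R) (ω : Ω) :
    ∑ i ∈ Finset.range n, m (z i ω) θ - ∑ i ∈ Finset.range n, m (z i ω) θ₀
      = n * (∫ x, m x θ ∂Q - ∫ x, m x θ₀ ∂Q)
        + √n * empProc Q z n (fun x => m x θ - m x θ₀) ω := by
  have hsn : √(n : ℝ) ≠ 0 := (Real.sqrt_pos.2 (by exact_mod_cast hn)).ne'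
  rw [empProc, mul_inv_cancel_left₀ hsn, integral_sub (hm.integrable _ hθ)
    (hm.integrable _ (by simpa using hm.radius_pos.le)), Finset.sum_sub_distrib,
    Finset.sum_sub_distrib]
  simp only [Finset.sum_const, Finset.card_range, nsmul_eq_mul]
  ring

variable [MeasurableSpace Ω] [FiniteDimensional ℝ E] {P : Measure Ω} [IsProbabilityMeasure P]
  [IsProbabilityMeasure Q] {z : ℕ → Ω → Z} {θhat : ℕ → Ω → E} {ρ : ℕ → Ω → ℝ}

/-- **Rate of convergence**: a consistent near-maximizer is `√n`-tight. -/
theorem exists_tight_bound (hlaw : ∀ i, HasLaw (z i) Q P) (hindep : iIndepFun z P) {c : ℝ}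
    (hc : 0 < c)
    (hquad : ∀ θ, ‖θ - θ₀‖ ≤ R → ∫ x, m x θ ∂Q - ∫ x, m x θ₀ ∂Q ≤ -(c * ‖θ - θ₀‖ ^ 2))
    (hcons : ∀ δ : ℝ, 0 < δ → Tendsto (fun n => P {ω | δ ≤ ‖θhat n ω - θ₀‖}) atTop (𝓝 0))
    (hρ : ∀ δ : ℝ, 0 < δ → Tendsto (fun n => P {ω | δ ≤ |ρ n ω|}) atTop (𝓝 0))
    (hnear : ∀ n, ∀ᵐ ω ∂P, ∀ θ, ‖θ - θ₀‖ ≤ R → ∑ i ∈ Finset.range n, m (z i ω) θ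
      ≤ ∑ i ∈ Finset.range n, m (z i ω) (θhat n ω) + ρ n ω) {η : ℝ≥0∞} (hη : 0 < η) :
    ∃ C : ℝ, 0 < C ∧ ∀ᶠ n : ℕ in atTop, P {ω | C ≤ √n * ‖θhat n ω - θ₀‖} ≤ η := by
  obtain ⟨K, hK, hb⟩ := hm.exists_local_bound hlaw hindep
  have hR := hm.radius_pos
  have hη4 : 0 < η / 4 := ENNReal.div_pos hη.ne' (by simp)
  have hc4 : 0 < c / 4 := by positivity
  have hhalf : Tendsto (fun J : ℕ => (2⁻¹ : ℝ) ^ J) atTop (𝓝 0) :=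
    tendsto_pow_atTop_nhds_zero_of_lt_one (by norm_num) (by norm_num)
  -- The first condition makes the noise of all shells beyond radius `2ᴶ/√n` improbable; the second
  -- gives `c 2ᴶ > 6` for the closing arithmetic.
  obtain ⟨J, hJ1, hJ2⟩ : ∃ J : ℕ,
      ENNReal.ofReal ((2⁻¹ : ℝ) ^ J) * 2 * K / ENNReal.ofReal (c / 4) ≤ η / 4 ∧
        (2⁻¹ : ℝ) ^ J < c / 6 := by
    have h1 : Tendsto (fun J : ℕ =>
        ENNReal.ofReal ((2⁻¹ : ℝ) ^ J) * 2 * K / ENNReal.ofReal (c / 4)) atTop (𝓝 0) := by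
      have h2 := ENNReal.tendsto_ofReal hhalf
      rw [ENNReal.ofReal_zero] at h2
      have h3 := ENNReal.Tendsto.div_const (ENNReal.Tendsto.mul_const
        (ENNReal.Tendsto.mul_const h2 (Or.inr (by simp : (2 : ℝ≥0∞) ≠ ⊤))) (Or.inr hK))
        (b := ENNReal.ofReal (c / 4)) (Or.inr (by simpa using hc))
      simpa using h3
    exact (((ENNReal.tendsto_nhds_zero.1 h1) _ hη4).and
      (hhalf.eventually_lt_const (by positivity))).exists
  refine ⟨2 ^ J, by positivity, ?_⟩
  have htail := tendsto_tailSq hm.measurable_const hm.integrable_sq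
  have hbad : ∀ᶠ n in atTop, ENNReal.ofReal (tailSq Q L n) ≤ η / 4 := by
    have h1 := ENNReal.tendsto_ofReal htail
    rw [ENNReal.ofReal_zero] at h1
    exact (ENNReal.tendsto_nhds_zero.1 h1) _ hη4
  filter_upwards [hbad, htail.eventually_lt_const one_pos,
    (ENNReal.tendsto_nhds_zero.1 (hcons (R / 4) (by positivity))) _ hη4,
    (ENNReal.tendsto_nhds_zero.1 (hρ 1 one_pos)) _ hη4, eventually_gt_atTop 0]
    with n hbad htail hcons hρ hn
  have hsn : 0 < √(n : ℝ) := Real.sqrt_pos.2 (by exact_mod_cast hn)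
  -- One fluctuation bound per shell. Shells too large for the local bound get `D = 0`; they are
  -- excluded later by consistency.
  have hD : ∀ j : ℕ, ∃ D : Ω → ℝ≥0∞, AEMeasurable D P ∧ ∫⁻ ω, D ω ∂P ≤ K ∧
      (2 * (2 ^ (j + 1) / √(n : ℝ)) ≤ R → ∀ ω, (∀ i < n, L (z i ω) ≤ √(n : ℝ)) →
        ∀ θ, ‖θ - θ₀‖ ≤ 2 ^ (j + 1) / √(n : ℝ) →
          ENNReal.ofReal |empProc Q z n (fun x => m x θ - m x θ₀) ω|
            ≤ ENNReal.ofReal (2 ^ (j + 1) / √(n : ℝ))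
              * (D ω + ENNReal.ofReal (tailSq Q L n))) := by
    intro j
    by_cases hj : 2 * (2 ^ (j + 1) / √(n : ℝ)) ≤ R
    · obtain ⟨D, h1, h2, h3⟩ := hb n hn _ (by positivity) hj
      exact ⟨D, h1, h2, fun _ => h3⟩
    · exact ⟨0, aemeasurable_const, by simp, fun h => absurd h hj⟩
  choose D hDm hDint hD using hD
  -- A weighted sum over the shells: one Markov inequality for `W` gives `D j < 2ʲ c/4` on all
  -- shells at once.
  let W : Ω → ℝ≥0∞ := fun ω => ∑' j, ENNReal.ofReal ((2⁻¹ : ℝ) ^ (j + J)) * D (j + J) ω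
  have hWm : AEMeasurable W P := AEMeasurable.tsum fun j => (hDm _).const_mul _
  have hgeom : ∑' j : ℕ, ENNReal.ofReal ((2⁻¹ : ℝ) ^ j) = 2 := by
    rw [← ENNReal.ofReal_tsum_of_nonneg (fun _ => by positivity)
      (summable_geometric_of_lt_one (by norm_num) (by norm_num)),
      tsum_geometric_of_lt_one (by norm_num) (by norm_num)]
    norm_num
  have hWint : ∫⁻ ω, W ω ∂P ≤ ENNReal.ofReal ((2⁻¹ : ℝ) ^ J) * 2 * K := by
    calc ∫⁻ ω, W ω ∂P = ∑' j, ENNReal.ofReal ((2⁻¹ : ℝ) ^ (j + J)) * ∫⁻ ω, D (j + J) ω ∂P := by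
          rw [lintegral_tsum fun j => (hDm _).const_mul _]
          exact tsum_congr fun j => lintegral_const_mul'' _ (hDm _)
      _ ≤ ∑' j : ℕ, ENNReal.ofReal ((2⁻¹ : ℝ) ^ j) * (ENNReal.ofReal ((2⁻¹ : ℝ) ^ J) * K) := by
          refine ENNReal.tsum_le_tsum fun j => ?_
          rw [pow_add, ENNReal.ofReal_mul (by positivity), mul_assoc]
          gcongr
          exact hDint _
      _ = _ := by rw [ENNReal.tsum_mul_right, hgeom]; ring
  have hincl : ∀ᵐ ω ∂P, ω ∈ {ω | 2 ^ J ≤ √(n : ℝ) * ‖θhat n ω - θ₀‖} →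
      ω ∈ (({ω | ¬ ∀ i < n, L (z i ω) ≤ √(n : ℝ)} ∪ {ω | R / 4 ≤ ‖θhat n ω - θ₀‖})
        ∪ {ω | 1 ≤ |ρ n ω|}) ∪ {ω | ENNReal.ofReal (c / 4) ≤ W ω} := by
    filter_upwards [hnear n] with ω hω hlarge
    by_contra hcon
    simp only [Set.mem_union, Set.mem_ofPred_eq, not_or, not_not, not_le] at hcon hlarge
    obtain ⟨⟨⟨hgood, hcl⟩, hr⟩, hW⟩ := hcon
    set x := √(n : ℝ) * ‖θhat n ω - θ₀‖ with hx
    have hx1 : (1 : ℝ) ≤ x := (one_le_pow₀ one_le_two).trans hlarge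
    obtain ⟨j, hj1, hj2⟩ := exists_nat_pow_near hx1 (one_lt_two (α := ℝ))
    have hJj : J ≤ j := by
      have h1 : (2 : ℝ) ^ J < 2 ^ (j + 1) := hlarge.trans_lt hj2
      have h2 := (pow_lt_pow_iff_right₀ (one_lt_two (α := ℝ))).1 h1
      omega
    obtain ⟨k, rfl⟩ := Nat.exists_eq_add_of_le' hJj
    have hDW : ENNReal.ofReal ((2⁻¹ : ℝ) ^ (k + J)) * D (k + J) ω < ENNReal.ofReal (c / 4) :=
      (ENNReal.le_tsum (f := fun j => ENNReal.ofReal ((2⁻¹ : ℝ) ^ (j + J)) * D (j + J) ω)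
        k).trans_lt hW
    have hDfin : D (k + J) ω ≠ ⊤ := by
      intro htop
      rw [htop, ENNReal.mul_top (by simp)] at hDW
      exact not_top_lt hDW
    set d := (D (k + J) ω).toReal with hd
    have hd0 : 0 ≤ d := ENNReal.toReal_nonneg
    have hDd : D (k + J) ω = ENNReal.ofReal d := (ENNReal.ofReal_toReal hDfin).symm
    rw [hDd, ← ENNReal.ofReal_mul (by positivity), ENNReal.ofReal_lt_ofReal_iff hc4] at hDW
    set y : ℝ := 2 ^ (k + J) with hy
    have hy0 : 0 < y := by positivity
    have hyinv : (2⁻¹ : ℝ) ^ (k + J) = y⁻¹ := by rw [hy, inv_pow]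
    rw [hyinv, inv_mul_lt_iff₀ hy0] at hDW
    have hθr : ‖θhat n ω - θ₀‖ ≤ 2 ^ (k + J + 1) / √(n : ℝ) := by
      rw [le_div_iff₀ hsn, mul_comm]; exact hj2.le
    have hyR : 2 * (2 ^ (k + J + 1) / √(n : ℝ)) ≤ R := by
      have h1 : y ≤ √(n : ℝ) * (R / 4) := hj1.trans (by rw [hx]; gcongr)
      rw [pow_succ, ← hy, ← mul_div_assoc, div_le_iff₀ hsn]
      linarith
    have hθR : ‖θhat n ω - θ₀‖ ≤ R := by linarith
    have hG := hD (k + J) hyR ω hgood _ hθr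
    rw [hDd, ← ENNReal.ofReal_add hd0 (tailSq_nonneg _ _ _), ← ENNReal.ofReal_mul (by positivity),
      ENNReal.ofReal_le_ofReal_iff (by have := tailSq_nonneg Q L n; positivity), pow_succ, ← hy,
      div_mul_eq_mul_div, le_div_iff₀ hsn] at hG
    have hnr := hω θ₀ (by simpa using hR.le)
    have hid := hm.sum_sub_eq (z := z) hn hθR ω
    have hq := hquad _ hθR
    have hxsq : x ^ 2 = n * ‖θhat n ω - θ₀‖ ^ 2 := by
      rw [hx, mul_pow, Real.sq_sqrt (Nat.cast_nonneg n)]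
    have hnq : n * (∫ x, m x (θhat n ω) ∂Q - ∫ x, m x θ₀ ∂Q) ≤ -(c * x ^ 2) := by
      rw [hxsq]
      calc _ ≤ n * (-(c * ‖θhat n ω - θ₀‖ ^ 2)) := by gcongr
        _ = _ := by ring
    have hGle := le_abs_self (empProc Q z n (fun x => m x (θhat n ω) - m x θ₀) ω)
    -- The quadratic drift must be paid for by noise. With `y ≤ x`, `d < cy/4` and `y ≥ 1` this
    -- forces `cy²/2 < 1 + 2y ≤ 3y`, against `cy > 6`.
    have hmain : c * x ^ 2 ≤ 1 + y * 2 * (d + 1) := by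
      have h1 : √(n : ℝ) * empProc Q z n (fun x => m x (θhat n ω) - m x θ₀) ω
          ≤ y * 2 * (d + 1) := by
        calc _ ≤ |empProc Q z n (fun x => m x (θhat n ω) - m x θ₀) ω| * √(n : ℝ) := by
              rw [mul_comm]; gcongr
          _ ≤ y * 2 * (d + tailSq Q L n) := hG
          _ ≤ _ := by gcongr
      linarith [(abs_lt.1 hr).2]
    have hcy : c * y ^ 2 ≤ c * x ^ 2 := by gcongr
    have hy6 : 6 < c * y := by
      have h1 : y⁻¹ < c / 6 := by
        rw [← hyinv]
        exact (pow_le_pow_of_le_one (by norm_num) (by norm_num) hJj).trans_lt hJ2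
      rw [inv_lt_iff_one_lt_mul₀ hy0] at h1
      linarith
    have hy1 : 1 ≤ y := one_le_pow₀ one_le_two
    nlinarith [mul_lt_mul_of_pos_left hDW hy0, mul_lt_mul_of_pos_left hy6 hy0]
  calc P _ ≤ _ := measure_mono_ae hincl
    _ ≤ η / 4 + η / 4 + η / 4 + η / 4 := by
      refine (measure_union_le _ _).trans (add_le_add ((measure_union_le _ _).trans
        (add_le_add ((measure_union_le _ _).trans (add_le_add ?_ hcons)) hρ)) ?_)
      · exact (meas_exists_sqrt_lt_le hlaw hm.measurable_const hm.integrable_sq n).trans hbad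
      · refine (meas_ge_le_lintegral_div hWm (by simpa using hc) ENNReal.ofReal_ne_top).trans ?_
        exact (ENNReal.div_le_div_right hWint _).trans hJ1
    _ = η := by
      rw [← ENNReal.add_div, ← ENNReal.add_div, ← ENNReal.add_div,
        show η + η + η + η = η * 4 by ring]
      exact ENNReal.mul_div_cancel_right (by simp) (by simp)

end LocallyLipschitz

end MEstimation

/-! ### Asymptotic linearity -/

namespace MEstimation

open EmpiricalProcess

variable {Ω Z E : Type*} [MeasurableSpace Z] [NormedAddCommGroup E] [InnerProductSpace ℝ E]
  [CompleteSpace E]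

/-- The normalized sum `n^{-1/2} ∑_{i<n} ψ(zᵢ)`. -/
noncomputable def scoreSum (ψ : Z → E) (z : ℕ → Ω → Z) (n : ℕ) (ω : Ω) : E :=
  (√(n : ℝ))⁻¹ • ∑ i ∈ Finset.range n, ψ (z i ω)

lemma empProc_inner {Q : Measure Z} {ψ : Z → E} (hψ : Integrable ψ Q) (h0 : ∫ x, ψ x ∂Q = 0)
    (z : ℕ → Ω → Z) (n : ℕ) (h : E) (ω : Ω) :
    empProc Q z n (fun x => inner ℝ (ψ x) h) ω = inner ℝ (scoreSum ψ z n ω) h := by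
  have : ∫ x, inner ℝ (ψ x) h ∂Q = 0 := by
    simp_rw [real_inner_comm h]
    rw [integral_inner hψ, h0, inner_zero_right]
  simp only [empProc, scoreSum, this, sub_zero, inner_smul_left, sum_inner]
  simp

namespace LocallyLipschitz

variable {Q : Measure Z} {m : Z → E → ℝ} {θ₀ : E} {R : ℝ} {L : Z → ℝ} {ψ : Z → E}
  (hm : LocallyLipschitz Q m θ₀ R L ψ)
include hm

lemma mono {R' : ℝ} (h0 : 0 < R') (h : R' ≤ R) : LocallyLipschitz Q m θ₀ R' L ψ where
  radius_pos := h0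
  measurable_const := hm.measurable_const
  const_nonneg := hm.const_nonneg
  integrable_sq := hm.integrable_sq
  integrable θ hθ := hm.integrable θ (hθ.trans h)
  lipschitz x θ θ' hθ hθ' := hm.lipschitz x θ θ' (hθ.trans h) (hθ'.trans h)
  hasGradientAt := hm.hasGradientAt
  measurable_grad := hm.measurable_grad
  norm_grad_le := hm.norm_grad_le

variable [MeasurableSpace Ω] [FiniteDimensional ℝ E] {P : Measure Ω} [IsProbabilityMeasure P]
  [IsProbabilityMeasure Q] {z : ℕ → Ω → Z} {θhat : ℕ → Ω → E} {ρ : ℕ → Ω → ℝ}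

/-- The norm of the score sum is its pairing with its own direction, which is random; the bound
uniform over unit vectors allows this choice. -/
lemma exists_tight_scoreSum (hlaw : ∀ i, HasLaw (z i) Q P) (hindep : iIndepFun z P)
    (h0 : ∫ x, ψ x ∂Q = 0) {η : ℝ≥0∞} (hη : 0 < η) :
    ∃ C : ℝ, 0 < C ∧ ∀ᶠ n : ℕ in atTop, P {ω | C ≤ ‖scoreSum ψ z n ω‖} ≤ η := by
  obtain ⟨K, hK, hb⟩ := hm.exists_score_bound hlaw hindep
  have hη2 : 0 < η / 2 := ENNReal.div_pos hη.ne' (by simp)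
  obtain ⟨N, hN, hN0⟩ : ∃ N : ℕ, K / (N : ℝ≥0∞) ≤ η / 2 ∧ 0 < N := by
    have h1 : Tendsto (fun N : ℕ => K / (N : ℝ≥0∞)) atTop (𝓝 0) := by
      simpa [div_eq_mul_inv] using
        ENNReal.Tendsto.const_mul ENNReal.tendsto_inv_nat_nhds_zero (Or.inr hK)
    exact (((ENNReal.tendsto_nhds_zero.1 h1) _ hη2).and (eventually_gt_atTop 0)).exists
  have htail := tendsto_tailSq hm.measurable_const hm.integrable_sq
  have hbad : ∀ᶠ n in atTop, ENNReal.ofReal (tailSq Q L n) ≤ η / 2 := by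
    have h1 := ENNReal.tendsto_ofReal htail
    rw [ENNReal.ofReal_zero] at h1
    exact (ENNReal.tendsto_nhds_zero.1 h1) _ hη2
  refine ⟨N + 1, by positivity, ?_⟩
  filter_upwards [hbad, htail.eventually_lt_const one_pos, eventually_gt_atTop 0]
    with n hbad htail hn
  obtain ⟨D, hDm, hDint, hD⟩ := hb n hn
  have hincl : {ω | (N : ℝ) + 1 ≤ ‖scoreSum ψ z n ω‖}
      ⊆ {ω | ¬ ∀ i < n, L (z i ω) ≤ √(n : ℝ)} ∪ {ω | (N : ℝ≥0∞) ≤ D ω} := by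
    intro ω hω
    by_contra hcon
    simp only [Set.mem_union, Set.mem_ofPred_eq, not_or, not_not, not_le] at hcon hω
    obtain ⟨hgood, hDω⟩ := hcon
    set G := scoreSum ψ z n ω with hG
    have hG0 : 0 < ‖G‖ := lt_of_lt_of_le (by positivity) hω
    have h1 := hD ω hgood (‖G‖⁻¹ • G) (by
      rw [norm_smul, norm_inv, norm_norm, inv_mul_cancel₀ hG0.ne'])
    rw [empProc_inner hm.integrable_grad h0, ← hG, inner_smul_right, real_inner_self_eq_norm_sq,
      sq, inv_mul_cancel_left₀ hG0.ne', abs_norm] at h1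
    have h2 : ENNReal.ofReal ‖G‖ < ENNReal.ofReal (N + 1) := by
      rw [ENNReal.ofReal_add (by positivity) zero_le_one, ENNReal.ofReal_natCast]
      exact h1.trans_lt (ENNReal.add_lt_add hDω ((ENNReal.ofReal_lt_ofReal_iff one_pos).2 htail))
    exact absurd ((ENNReal.ofReal_lt_ofReal_iff (by positivity)).1 h2) (not_lt.2 hω)
  calc P _ ≤ _ := measure_mono hincl
    _ ≤ η / 2 + η / 2 := by
      refine (measure_union_le _ _).trans (add_le_add ?_ ?_)
      · exact (meas_exists_sqrt_lt_le hlaw hm.measurable_const hm.integrable_sq n).trans hbad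
      · refine (meas_ge_le_lintegral_div hDm (by simpa using hN0.ne') (by simp)).trans ?_
        exact (ENNReal.div_le_div_right hDint _).trans hN
    _ = η := ENNReal.add_halves η

/-- **Asymptotic linearity of M-estimators** for Lipschitz criteria whose expectation has a
nondegenerate second-order expansion, with negative Hessian `T` and `W = T⁻¹`. -/
theorem tendsto_linearization (hlaw : ∀ i, HasLaw (z i) Q P) (hindep : iIndepFun z P)
    {T W : E →L[ℝ] E} {c : ℝ} (hc : 0 < c) (hsymm : ∀ x y, inner ℝ (T x) y = inner ℝ x (T y))
    (hpos : ∀ x, 2 * c * ‖x‖ ^ 2 ≤ inner ℝ (T x) x) (hTW : ∀ g, T (W g) = g)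
    (hexp : (fun θ => ∫ x, m x θ ∂Q - ∫ x, m x θ₀ ∂Q + 1 / 2 * inner ℝ (T (θ - θ₀)) (θ - θ₀))
      =o[𝓝 θ₀] fun θ => ‖θ - θ₀‖ ^ 2)
    (hcons : ∀ δ : ℝ, 0 < δ → Tendsto (fun n => P {ω | δ ≤ ‖θhat n ω - θ₀‖}) atTop (𝓝 0))
    (hρ : ∀ δ : ℝ, 0 < δ → Tendsto (fun n => P {ω | δ ≤ |ρ n ω|}) atTop (𝓝 0))
    (hnear : ∀ n, ∀ᵐ ω ∂P, ∀ θ, ‖θ - θ₀‖ ≤ R → ∑ i ∈ Finset.range n, m (z i ω) θ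
      ≤ ∑ i ∈ Finset.range n, m (z i ω) (θhat n ω) + ρ n ω) {ε : ℝ} (hε : 0 < ε) :
    Tendsto (fun n : ℕ => P {ω | ε ≤ ‖√(n : ℝ) • (θhat n ω - θ₀) - W (scoreSum ψ z n ω)‖})
      atTop (𝓝 0) := by
  have hexp' : ∀ a : ℝ, 0 < a → ∃ r : ℝ, 0 < r ∧ ∀ θ, ‖θ - θ₀‖ ≤ r →
      |∫ x, m x θ ∂Q - ∫ x, m x θ₀ ∂Q + 1 / 2 * inner ℝ (T (θ - θ₀)) (θ - θ₀)|
        ≤ a * ‖θ - θ₀‖ ^ 2 := by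
    intro a ha
    obtain ⟨r, hr, h⟩ := Metric.nhds_basis_closedBall.eventually_iff.1 (hexp.def ha)
    refine ⟨r, hr, fun θ hθ => ?_⟩
    have := h (mem_closedBall_iff_norm.2 hθ)
    simpa using this
  -- Coercivity gives a drift of at most `-c‖θ - θ₀‖²` up to the expansion error; an error of `c/2`
  -- leaves `-c/2`.
  obtain ⟨r₁, hr₁, hexp₁⟩ := hexp' (c / 2) (by positivity)
  have hm' := hm.mono (lt_min hm.radius_pos hr₁) (min_le_left _ _)
  have hquad : ∀ θ, ‖θ - θ₀‖ ≤ min R r₁ →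
      ∫ x, m x θ ∂Q - ∫ x, m x θ₀ ∂Q ≤ -(c / 2 * ‖θ - θ₀‖ ^ 2) := fun θ hθ => by
    have h1 := (abs_le.1 (hexp₁ θ (hθ.trans (min_le_right _ _)))).2
    have h2 := hpos (θ - θ₀)
    linarith
  have hψ0 := hm'.integral_grad_eq_zero fun θ hθ => by
    have h1 := hquad θ hθ
    have h2 : 0 ≤ c / 2 * ‖θ - θ₀‖ ^ 2 := by positivity
    linarith
  rw [ENNReal.tendsto_nhds_zero]
  intro η hη
  have hη4 : 0 < η / 4 := ENNReal.div_pos hη.ne' (by simp)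
  obtain ⟨C₁, hC₁, htight₁⟩ := hm'.exists_tight_bound hlaw hindep (by positivity) hquad hcons hρ
    (fun n => (hnear n).mono fun ω h θ hθ => h θ (hθ.trans (min_le_left _ _))) hη4
  obtain ⟨C₂, hC₂, htight₂⟩ := hm.exists_tight_scoreSum hlaw hindep hψ0 hη4
  -- Large enough to contain both the rescaled estimator and the peak `W G` of the quadratic.
  set C := C₁ + ‖W‖ * C₂ with hC
  have hC0 : 0 < C := by positivity
  -- The quadratic approximation costs `2κ` at each of two points and `ρ` less than `κ`, in all less
  -- than `5κ`, while a distance `ε` from the peak loses at least `cε² = 6κ`.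
  set κ := c * ε ^ 2 / 6 with hκ
  have hκ0 : 0 < κ := by positivity
  obtain ⟨r₂, hr₂, hexp₂⟩ := hexp' (κ / C ^ 2) (by positivity)
  have hinv : Tendsto (fun n : ℕ => (√(n : ℝ))⁻¹ * C) atTop (𝓝 0) := by
    simpa using (tendsto_inv_atTop_zero.comp
      (Real.tendsto_sqrt_atTop.comp tendsto_natCast_atTop_atTop)).mul_const C
  filter_upwards [htight₁, htight₂,
    (ENNReal.tendsto_nhds_zero.1 (hm.tendsto_sup_remainder hlaw hindep hC0 hκ0)) _ hη4,
    (ENNReal.tendsto_nhds_zero.1 (hρ κ hκ0)) _ hη4, hinv.eventually_lt_const hr₂,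
    hinv.eventually_lt_const hm.radius_pos, eventually_gt_atTop 0]
    with n htight₁ htight₂ hsup hρ hnr₂ hnR hn
  have hn' : (0 : ℝ) < n := by exact_mod_cast hn
  have hsn : 0 < √(n : ℝ) := Real.sqrt_pos.2 hn'
  have hincl : ∀ᵐ ω ∂P, ω ∈ {ω | ε ≤ ‖√(n : ℝ) • (θhat n ω - θ₀) - W (scoreSum ψ z n ω)‖} →
      ω ∈ (({ω | C₁ ≤ √(n : ℝ) * ‖θhat n ω - θ₀‖} ∪ {ω | C₂ ≤ ‖scoreSum ψ z n ω‖})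
        ∪ {ω | ∃ h : E, ‖h‖ ≤ C ∧
          κ ≤ |√n * empProc Q z n (fun x => m x (θ₀ + (√(n : ℝ))⁻¹ • h) - m x θ₀) ω
            - empProc Q z n (fun x => inner ℝ (ψ x) h) ω|}) ∪ {ω | κ ≤ |ρ n ω|} := by
    filter_upwards [hnear n] with ω hω hlarge
    by_contra hcon
    simp only [Set.mem_union, Set.mem_ofPred_eq, not_or, not_exists, not_and, not_le] at hcon hlarge
    obtain ⟨⟨⟨ht₁, ht₂⟩, hrem⟩, hr⟩ := hcon
    set G := scoreSum ψ z n ω with hG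
    have hball : ∀ h : E, ‖h‖ ≤ C → ‖θ₀ + (√(n : ℝ))⁻¹ • h - θ₀‖ ≤ (√(n : ℝ))⁻¹ * C := by
      intro h hh
      rw [add_sub_cancel_left, norm_smul, Real.norm_of_nonneg (by positivity)]
      gcongr
    have hlan : ∀ h : E, ‖h‖ ≤ C →
        |∑ i ∈ Finset.range n, m (z i ω) (θ₀ + (√(n : ℝ))⁻¹ • h)
          - ∑ i ∈ Finset.range n, m (z i ω) θ₀
          - (inner ℝ G h - 1 / 2 * inner ℝ (T h) h)| ≤ 2 * κ := by
      intro h hh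
      have hb := hball h hh
      have h1 := hrem h hh
      rw [empProc_inner hm.integrable_grad hψ0, ← hG] at h1
      have h2 := hexp₂ _ (hb.trans hnr₂.le)
      simp only [add_sub_cancel_left, map_smul, inner_smul_left, inner_smul_right, norm_smul,
        conj_trivial, Real.norm_of_nonneg (inv_nonneg.2 hsn.le)] at h2
      rw [hm.sum_sub_eq hn (hb.trans hnR.le)]
      have h3 : |n * (∫ x, m x (θ₀ + (√(n : ℝ))⁻¹ • h) ∂Q - ∫ x, m x θ₀ ∂Q)
          + 1 / 2 * inner ℝ (T h) h| ≤ κ := by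
        have h4 : n * (∫ x, m x (θ₀ + (√(n : ℝ))⁻¹ • h) ∂Q - ∫ x, m x θ₀ ∂Q)
            + 1 / 2 * inner ℝ (T h) h
            = n * (∫ x, m x (θ₀ + (√(n : ℝ))⁻¹ • h) ∂Q - ∫ x, m x θ₀ ∂Q
              + 1 / 2 * ((√(n : ℝ))⁻¹ * ((√(n : ℝ))⁻¹ * inner ℝ (T h) h))) := by
          have : (n : ℝ) * ((√(n : ℝ))⁻¹ * (√(n : ℝ))⁻¹) = 1 := by
            rw [← mul_inv, Real.mul_self_sqrt hn'.le, mul_inv_cancel₀ hn'.ne']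
          linear_combination (-(1 / 2) * inner ℝ (T h) h) * this
        rw [h4, abs_mul, abs_of_pos hn']
        calc _ ≤ n * (κ / C ^ 2 * ((√(n : ℝ))⁻¹ * ‖h‖) ^ 2) := by gcongr
          _ = κ / C ^ 2 * ‖h‖ ^ 2 := by
            rw [mul_pow, inv_pow, Real.sq_sqrt hn'.le]
            field_simp
          _ ≤ κ / C ^ 2 * C ^ 2 := by gcongr
          _ = κ := by field_simp
      have h5 := abs_add_le (n * (∫ x, m x (θ₀ + (√(n : ℝ))⁻¹ • h) ∂Q - ∫ x, m x θ₀ ∂Q)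
          + 1 / 2 * inner ℝ (T h) h)
        (√n * empProc Q z n (fun x => m x (θ₀ + (√(n : ℝ))⁻¹ • h) - m x θ₀) ω - inner ℝ G h)
      refine le_trans (le_of_eq ?_) (h5.trans (by linarith))
      congr 1
      ring
    set u := √(n : ℝ) • (θhat n ω - θ₀) with hu
    set w := W G with hw
    have huC : ‖u‖ ≤ C := by
      rw [hu, norm_smul, Real.norm_of_nonneg hsn.le, hC]
      have : 0 ≤ ‖W‖ * C₂ := by positivity
      linarith
    have hwC : ‖w‖ ≤ C := by
      have h1 : ‖W G‖ ≤ ‖W‖ * C₂ := (W.le_opNorm G).trans (by gcongr)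
      rw [hw, hC]; linarith
    have hθu : θ₀ + (√(n : ℝ))⁻¹ • u = θhat n ω := by
      rw [hu, smul_smul, inv_mul_cancel₀ hsn.ne', one_smul, add_sub_cancel]
    have hlu := abs_le.1 (hlan u huC)
    have hlw := abs_le.1 (hlan w hwC)
    rw [hθu] at hlu
    have hnw := hω (θ₀ + (√(n : ℝ))⁻¹ • w) ((hball w hwC).trans hnR.le)
    have hGw : G = T w := (hTW G).symm
    -- Completing the square around the peak, where `G = T w`.
    have hq : inner ℝ G w - 1 / 2 * inner ℝ (T w) w - (inner ℝ G u - 1 / 2 * inner ℝ (T u) u)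
        = 1 / 2 * inner ℝ (T (u - w)) (u - w) := by
      rw [hGw, map_sub, inner_sub_left, inner_sub_right, inner_sub_right, hsymm u w,
        real_inner_comm u (T w)]
      ring
    have hp := hpos (u - w)
    have hεu : ε ^ 2 ≤ ‖u - w‖ ^ 2 := by gcongr
    have hcε : c * ε ^ 2 ≤ c * ‖u - w‖ ^ 2 := by gcongr
    have h6 : c * ε ^ 2 = 6 * κ := by rw [hκ]; ring
    linarith [(abs_lt.1 hr).2, hlu.1, hlu.2, hlw.1, hlw.2]
  calc P _ ≤ _ := measure_mono_ae hincl
    _ ≤ η / 4 + η / 4 + η / 4 + η / 4 :=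
      (measure_union_le _ _).trans (add_le_add ((measure_union_le _ _).trans
        (add_le_add ((measure_union_le _ _).trans (add_le_add htight₁ htight₂)) hsup)) hρ)
    _ = η := by
      rw [← ENNReal.add_div, ← ENNReal.add_div, ← ENNReal.add_div,
        show η + η + η + η = η * 4 by ring]
      exact ENNReal.mul_div_cancel_right (by simp) (by simp)

end LocallyLipschitz

end MEstimation

namespace MEstimation

open EmpiricalProcess

/-! ### Multivariate central limit theorem -/

section CentralLimit

variable {Ω Z : Type*} [MeasurableSpace Ω] [MeasurableSpace Z] {P : Measure Ω}
  [IsProbabilityMeasure P] {Q : Measure Z} {z : ℕ → Ω → Z} {p : ℕ}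

/-- Multivariate central limit theorem. -/
theorem tendstoInDistribution_scoreSum (hlaw : ∀ i, HasLaw (z i) Q P) (hindep : iIndepFun z P)
    {ξ : Z → EuclideanSpace ℝ (Fin p)} (hξ : MemLp ξ 2 Q) (h0 : ∫ x, ξ x ∂Q = 0)
    {V : Matrix (Fin p) (Fin p) ℝ} (hV : V.PosSemidef)
    (hcov : ∀ t : EuclideanSpace ℝ (Fin p),
      ∫ x, inner ℝ (ξ x) t ^ 2 ∂Q = t.ofLp ⬝ᵥ (V *ᵥ t.ofLp)) :
    TendstoInDistribution (scoreSum ξ z) atTop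
      (id : EuclideanSpace ℝ (Fin p) → EuclideanSpace ℝ (Fin p)) (fun _ => P)
      (multivariateGaussian 0 V) := by
  have hQ : IsProbabilityMeasure Q := (hlaw 0).isProbabilityMeasure_iff.1 inferInstance
  have hmeas : ∀ n, AEMeasurable (scoreSum ξ z n) P := fun n =>
    (Finset.aemeasurable_fun_sum _ fun i _ => aemeasurable_comp hlaw hξ.1 i).fun_const_smul _
  refine ⟨hmeas, aemeasurable_id, ProbabilityMeasure.tendsto_iff_tendsto_charFun.2 fun t => ?_⟩
  set X : ℕ → Ω → ℝ := fun i ω => inner ℝ (ξ (z i ω)) t with hX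
  have hfm : AEStronglyMeasurable (fun x => inner ℝ (ξ x) t) Q :=
    hξ.1.inner aestronglyMeasurable_const
  have hf2 : MemLp (fun x => inner ℝ (ξ x) t) 2 Q := by
    refine MemLp.of_le_mul (c := ‖t‖) hξ hfm (Eventually.of_forall fun x => ?_)
    rw [mul_comm]
    exact norm_inner_le_norm _ _
  have hident : ∀ i, IdentDistrib (X i) (X 0) P P := fun i => by
    have h1 : IdentDistrib (z i) (z 0) P P :=
      ⟨(hlaw i).aemeasurable, (hlaw 0).aemeasurable, by rw [(hlaw i).map_eq, (hlaw 0).map_eq]⟩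
    refine ⟨aemeasurable_comp hlaw hfm i, aemeasurable_comp hlaw hfm 0, ?_⟩
    have hmap : ∀ j, P.map (X j) = Q.map (fun x => inner ℝ (ξ x) t) := fun j => by
      have hfm' := hfm.aemeasurable
      rw [← (hlaw j).map_eq] at hfm' ⊢
      rw [AEMeasurable.map_map_of_aemeasurable hfm' (hlaw j).aemeasurable]
      rfl
    rw [hmap i, hmap 0]
  have hX2 : MemLp (X 0) 2 P := by
    have h := hf2
    rw [← (hlaw 0).map_eq] at h
    exact h.comp_of_map (hlaw 0).aemeasurable
  have hmean : ∫ ω, X 0 ω ∂P = 0 := by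
    refine ((hlaw 0).integral_comp hfm).trans ?_
    simp_rw [real_inner_comm t]
    rw [integral_inner (hξ.integrable one_le_two), h0, inner_zero_right]
  have hvar : Var[X 0; P] = t.ofLp ⬝ᵥ (V *ᵥ t.ofLp) := by
    rw [variance_of_integral_eq_zero hX2.1.aemeasurable hmean, ← hcov]
    exact (hlaw 0).integral_comp (hfm.pow 2)
  have hclt := tendstoInDistribution_inv_sqrt_mul_sum_sub (P := P)
    (P' := gaussianReal 0 Var[X 0; P].toNNReal) (Y := id) HasLaw.id hX2
    (iIndepFun_comp hlaw hindep hfm) hident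
  -- Cramér–Wold: the characteristic function of the vector sum at `t` is that of its projection on
  -- `t` at `1`.
  have hchar := (ProbabilityMeasure.tendsto_iff_tendsto_charFun.1 hclt.tendsto) 1
  simp only [hmean, mul_zero, sub_zero, ProbabilityMeasure.coe_mk, Measure.map_id] at hchar
  rw [charFun_gaussianReal] at hchar
  simp only [ProbabilityMeasure.coe_mk, Measure.map_id]
  rw [charFun_multivariateGaussian hV]
  have hvn : 0 ≤ Var[X 0; P] := variance_nonneg _ _
  convert hchar using 2
  · rename_i n
    rw [charFun_apply, charFun_apply, integral_map (hmeas n) (by fun_prop),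
      integral_map (Finset.aemeasurable_fun_sum _ (fun i _ => (hident i).aemeasurable_fst)
        |>.const_mul _) (by fun_prop)]
    refine integral_congr_ae (Eventually.of_forall fun ω => ?_)
    simp [scoreSum, hX, inner_smul_left, sum_inner]
  · rw [Real.coe_toNNReal _ hvn, hvar]
    simp

end CentralLimit

/-! ### Quadratic forms of the matrices `A` and `B` -/

section Glue

variable {p : ℕ}

lemma inner_toEuclideanCLM (A : Matrix (Fin p) (Fin p) ℝ) (x y : EuclideanSpace ℝ (Fin p)) :
    inner ℝ (Matrix.toEuclideanCLM (𝕜 := ℝ) A x) y = y.ofLp ⬝ᵥ (A *ᵥ x.ofLp) := by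
  rw [EuclideanSpace.inner_eq_star_dotProduct, Matrix.ofLp_toEuclideanCLM, star_trivial]

lemma inner_toEuclideanCLM_left (A : Matrix (Fin p) (Fin p) ℝ)
    (x y : EuclideanSpace ℝ (Fin p)) :
    inner ℝ (Matrix.toEuclideanCLM (𝕜 := ℝ) A x) y
      = inner ℝ x (Matrix.toEuclideanCLM (𝕜 := ℝ) Aᵀ y) := by
  rw [inner_toEuclideanCLM, ← real_inner_comm, inner_toEuclideanCLM, Matrix.mulVec_transpose,
    Matrix.dotProduct_mulVec, dotProduct_comm]

lemma exists_coercive {A : Matrix (Fin p) (Fin p) ℝ} (hA : A.PosDef) :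
    ∃ c : ℝ, 0 < c ∧ ∀ x : EuclideanSpace ℝ (Fin p),
      2 * c * ‖x‖ ^ 2 ≤ inner ℝ (Matrix.toEuclideanCLM (𝕜 := ℝ) A x) x := by
  set T := Matrix.toEuclideanCLM (𝕜 := ℝ) A with hT
  have hpos : ∀ x : EuclideanSpace ℝ (Fin p), x ≠ 0 → 0 < inner ℝ (T x) x := fun x hx => by
    rw [hT, inner_toEuclideanCLM]
    simpa using hA.dotProduct_mulVec_pos (x := x.ofLp) (by simpa using hx)
  -- The sphere is empty when `p = 0`; otherwise the minimum of the form over it is the constant.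
  rcases (Metric.sphere (0 : EuclideanSpace ℝ (Fin p)) 1).eq_empty_or_nonempty with he | hne
  · refine ⟨1, one_pos, fun x => ?_⟩
    have hx : x = 0 := by
      by_contra hx
      have : ‖x‖⁻¹ • x ∈ Metric.sphere (0 : EuclideanSpace ℝ (Fin p)) 1 := by
        rw [mem_sphere_zero_iff_norm, norm_smul, norm_inv, norm_norm,
          inv_mul_cancel₀ (norm_ne_zero_iff.2 hx)]
      rw [he] at this
      exact this
    simp [hx]
  · obtain ⟨x₀, hx₀, hmin⟩ := (isCompact_sphere (0 : EuclideanSpace ℝ (Fin p)) 1).exists_isMinOn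
      hne (f := fun x => inner ℝ (T x) x) (by fun_prop)
    have hx₀n : x₀ ≠ 0 := by
      rintro rfl
      simp at hx₀
    refine ⟨inner ℝ (T x₀) x₀ / 2, half_pos (hpos x₀ hx₀n), fun x => ?_⟩
    by_cases hx : x = 0
    · simp [hx]
    have hn : 0 < ‖x‖ := norm_pos_iff.2 hx
    have h1 : inner ℝ (T x₀) x₀ ≤ inner ℝ (T (‖x‖⁻¹ • x)) (‖x‖⁻¹ • x) := hmin (by
      rw [mem_sphere_zero_iff_norm, norm_smul, norm_inv, norm_norm, inv_mul_cancel₀ hn.ne'])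
    rw [map_smul, inner_smul_left, inner_smul_right, conj_trivial, ← mul_assoc, ← mul_inv, ← sq,
      le_inv_mul_iff₀ (by positivity)] at h1
    linarith

variable {Z : Type*} [MeasurableSpace Z] {Q : Measure Z}

/-- The quadratic form of the second moment matrix of the score. -/
lemma dotProduct_matB_mulVec {m : Z → EuclideanSpace ℝ (Fin p) → ℝ} {θ : EuclideanSpace ℝ (Fin p)}
    (h2 : MemLp (fun x => MEst.score m x θ) 2 Q) (t : EuclideanSpace ℝ (Fin p)) :
    t.ofLp ⬝ᵥ (MEst.matB Q m θ *ᵥ t.ofLp) = ∫ x, inner ℝ (MEst.score m x θ) t ^ 2 ∂Q := by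
  have hcoord : ∀ i, MemLp (fun x => MEst.score m x θ i) 2 Q := fun i =>
    (EuclideanSpace.proj (𝕜 := ℝ) i).comp_memLp' h2
  have hint : ∀ i j, Integrable (fun x => MEst.score m x θ i * MEst.score m x θ j) Q :=
    fun i j => (hcoord i).integrable_mul (hcoord j)
  have hsq : ∀ x, inner ℝ (MEst.score m x θ) t ^ 2
      = ∑ i, ∑ j, t i * (MEst.score m x θ i * MEst.score m x θ j * t j) := fun x => by
    rw [EuclideanSpace.inner_eq_star_dotProduct, star_trivial, dotProduct, sq,
      Finset.sum_mul_sum]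
    refine Finset.sum_congr rfl fun i _ => Finset.sum_congr rfl fun j _ => ?_
    ring
  simp_rw [hsq]
  rw [integral_finsetSum _ fun i _ => integrable_finsetSum _ fun j _ =>
    ((hint i j).mul_const _).const_mul _]
  simp only [dotProduct, Matrix.mulVec]
  refine Finset.sum_congr rfl fun i _ => ?_
  rw [integral_finsetSum _ fun j _ => ((hint i j).mul_const _).const_mul _, Finset.mul_sum]
  refine Finset.sum_congr rfl fun j _ => ?_
  rw [integral_const_mul, integral_mul_const]
  rfl

lemma posSemidef_matB {m : Z → EuclideanSpace ℝ (Fin p) → ℝ} {θ : EuclideanSpace ℝ (Fin p)}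
    (h2 : MemLp (fun x => MEst.score m x θ) 2 Q) : (MEst.matB Q m θ).PosSemidef := by
  refine Matrix.PosSemidef.of_dotProduct_mulVec_nonneg ?_ fun x => ?_
  · ext i j
    simp only [MEst.matB, Matrix.conjTranspose_apply, Matrix.of_apply, star_trivial]
    simp_rw [mul_comm]
  · have h := dotProduct_matB_mulVec h2 (WithLp.toLp 2 x)
    rw [star_trivial]
    rw [h]
    exact integral_nonneg fun _ => sq_nonneg _

end Glue

/-! ### From score dominance to a locally Lipschitz criterion -/

section Regularity

variable {Z : Type*} [MeasurableSpace Z] {Q : Measure Z} {p : ℕ}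
  {m : Z → EuclideanSpace ℝ (Fin p) → ℝ} {Θ : Set (EuclideanSpace ℝ (Fin p))}
  {θ₀ : EuclideanSpace ℝ (Fin p)}

/-- Each partial derivative is a limit of difference quotients along the coordinate axis, taken far
enough in the sequence to stay where `m` is measurable. -/
lemma aestronglyMeasurable_score (hint : ∀ᶠ θ in 𝓝 θ₀, AEStronglyMeasurable (fun x => m x θ) Q)
    (hdiff : ∀ x, DifferentiableAt ℝ (m x) θ₀) :
    AEStronglyMeasurable (fun x => MEst.score m x θ₀) Q := by
  have hcoord : ∀ i, AEMeasurable (fun x => MEst.score m x θ₀ i) Q := fun i => by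
    have hpath : Tendsto (fun a : ℝ => θ₀ + a • EuclideanSpace.single i (1 : ℝ)) (𝓝 0) (𝓝 θ₀) := by
      have : Continuous fun a : ℝ => θ₀ + a • EuclideanSpace.single i (1 : ℝ) := by fun_prop
      simpa using this.tendsto 0
    have hseq : Tendsto (fun n : ℕ => ((n : ℝ) + 1)⁻¹) atTop (𝓝 0) := by
      simpa [one_div] using tendsto_one_div_add_atTop_nhds_zero_nat (𝕜 := ℝ)
    obtain ⟨N, hN⟩ := eventually_atTop.1 ((hpath.comp hseq).eventually hint)
    have hseqN := (tendsto_add_atTop_iff_nat N).2 hseq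
    refine aemeasurable_of_tendsto_metrizable_ae atTop
      (f := fun n x => ((((n + N : ℕ) : ℝ) + 1)⁻¹)⁻¹ •
        (m x (θ₀ + (((n + N : ℕ) : ℝ) + 1)⁻¹ • EuclideanSpace.single i (1 : ℝ)) - m x θ₀))
      (fun n => ((hN (n + N) (Nat.le_add_left _ _)).aemeasurable.sub
        hint.self_of_nhds.aemeasurable).fun_const_smul _)
      (Eventually.of_forall fun x => ?_)
    have hg : HasDerivAt (fun b : ℝ => m x (θ₀ + b • EuclideanSpace.single i (1 : ℝ)))
        (MEst.score m x θ₀ i) 0 := by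
      have h1 : HasDerivAt (fun b : ℝ => θ₀ + b • EuclideanSpace.single i (1 : ℝ))
          (EuclideanSpace.single i (1 : ℝ)) 0 := by
        simpa using ((hasDerivAt_id (0 : ℝ)).smul_const
          (EuclideanSpace.single i (1 : ℝ))).const_add θ₀
      have h2 : HasFDerivAt (m x) (InnerProductSpace.toDual ℝ _ (MEst.score m x θ₀))
          (θ₀ + (0 : ℝ) • EuclideanSpace.single i (1 : ℝ)) := by
        rw [zero_smul, add_zero]
        exact (hdiff x).hasGradientAt.hasFDerivAt
      have h3 := h2.comp_hasDerivAt (0 : ℝ) h1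
      rw [InnerProductSpace.toDual_apply_apply, EuclideanSpace.inner_single_right,
        one_mul, conj_trivial] at h3
      exact h3
    have hs := hg.tendsto_slope_zero
    have ha : Tendsto (fun n : ℕ => (((n + N : ℕ) : ℝ) + 1)⁻¹) atTop (𝓝[≠] 0) :=
      tendsto_nhdsWithin_iff.2 ⟨hseqN, Eventually.of_forall fun n =>
        inv_ne_zero (by positivity)⟩
    have hs' := hs.comp ha
    simp only [zero_add, zero_smul, add_zero] at hs'
    exact hs'
  have h1 : AEMeasurable (fun x i => MEst.score m x θ₀ i) Q := aemeasurable_pi_iff.2 hcoord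
  have h2 : AEMeasurable (fun x => WithLp.toLp 2 fun i => MEst.score m x θ₀ i) Q :=
    (WithLp.measurable_toLp 2 _).comp_aemeasurable h1
  exact h2.aestronglyMeasurable

/-- Local dominance of the score makes the criterion locally Lipschitz. -/
lemma exists_locallyLipschitz (hint : ∀ θ ∈ Θ, Integrable (fun x => m x θ) Q)
    (hθ₀ : θ₀ ∈ interior Θ) (hreg : MEst.Regularity Q m Θ θ₀) :
    ∃ (R : ℝ) (L : Z → ℝ), Metric.closedBall θ₀ R ⊆ Θ ∧
      LocallyLipschitz Q m θ₀ R L fun x => MEst.score m x θ₀ := by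
  obtain ⟨δ, hδ, L, hLm, hL2, hdom⟩ := hreg.dominance
  obtain ⟨r, hr, hball⟩ := Metric.mem_nhds_iff.1 (isOpen_interior.mem_nhds hθ₀)
  set R := min (r / 2) δ with hR
  have hR0 : 0 < R := lt_min (half_pos hr) hδ
  have hsub : Metric.closedBall θ₀ R ⊆ interior Θ := fun θ hθ => hball
    (Metric.mem_ball.2 ((Metric.mem_closedBall.1 hθ).trans_lt
      ((min_le_left _ _).trans_lt (half_lt_self hr))))
  have hmem : ∀ θ, ‖θ - θ₀‖ ≤ R → θ ∈ interior Θ := fun θ hθ =>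
    hsub (mem_closedBall_iff_norm.2 hθ)
  have hdiff : ∀ x, ∀ θ ∈ interior Θ, DifferentiableAt ℝ (m x) θ := fun x θ hθ =>
    (hreg.differentiable x).differentiableAt (mem_interior_iff_mem_nhds.1 hθ)
  have hθ₀R : ‖θ₀ - θ₀‖ ≤ δ := by simpa using hδ.le
  refine ⟨R, L, hsub.trans interior_subset, hR0, hLm, fun x => (norm_nonneg _).trans
    (hdom x θ₀ (interior_subset hθ₀) hθ₀R), hL2,
    fun θ hθ => hint θ (interior_subset (hmem θ hθ)), fun x θ θ' hθ hθ' => ?_,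
    fun x => (hdiff x θ₀ hθ₀).hasGradientAt, aestronglyMeasurable_score ?_ fun x => hdiff x θ₀ hθ₀,
    fun x => hdom x θ₀ (interior_subset hθ₀) hθ₀R⟩
  -- Mean value inequality on the ball; the Riesz isometry identifies the norms of score and
  -- derivative.
  · refine (convex_closedBall θ₀ R).norm_image_sub_le_of_norm_fderiv_le (𝕜 := ℝ)
      (fun y hy => hdiff x y (hsub hy)) (fun y hy => ?_) (mem_closedBall_iff_norm.2 hθ')
      (mem_closedBall_iff_norm.2 hθ)
    have h1 := hdom x y (interior_subset (hsub hy))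
      ((mem_closedBall_iff_norm.1 hy).trans (min_le_right _ _))
    rwa [MEst.score, gradient, LinearIsometryEquiv.norm_map] at h1
  · filter_upwards [isOpen_interior.mem_nhds hθ₀] with θ hθ
    exact (hint θ (interior_subset hθ)).aestronglyMeasurable

end Regularity

/-! ### Consistency -/

section Consistency

variable {Ω Z : Type*} [MeasurableSpace Ω] [MeasurableSpace Z] {P : Measure Ω} {Q : Measure Z}
  {p : ℕ} {m : Z → EuclideanSpace ℝ (Fin p) → ℝ} {z : ℕ → Ω → Z}
  {Θ : Set (EuclideanSpace ℝ (Fin p))} {θ₀ : EuclideanSpace ℝ (Fin p)}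
  {θhat : ℕ → Ω → EuclideanSpace ℝ (Fin p)}

/-- Consistency of near-maximizers of a uniformly convergent criterion. -/
lemma tendsto_meas_norm_sub_ge (hident : MEst.Identification P Q m z Θ θ₀ θhat) {δ : ℝ}
    (hδ : 0 < δ) : Tendsto (fun n => P {ω | δ ≤ ‖θhat n ω - θ₀‖}) atTop (𝓝 0) := by
  -- The supremum may be `-∞`, so the gap is measured from a real number in between. A third of it
  -- is allotted to each deviation, at `θhat` and at `θ₀`, and to `r`.
  obtain ⟨γ, hγ1, hγ2⟩ := EReal.lt_iff_exists_real_btwn.1 (hident.well_separated δ hδ)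
  have hγ2' : γ < MEst.popCrit Q m θ₀ := EReal.coe_lt_coe_iff.1 hγ2
  set κ := (MEst.popCrit Q m θ₀ - γ) / 3 with hκ
  have hκ0 : 0 < κ := by rw [hκ]; linarith
  obtain ⟨r, hr, hnear⟩ := hident.near_max
  have hsum := (hident.uniform_conv κ hκ0).add ((tendstoInMeasure_iff_norm.1 hr) κ hκ0)
  rw [add_zero] at hsum
  refine tendsto_of_tendsto_of_tendsto_of_le_of_le' tendsto_const_nhds hsum
    (Eventually.of_forall fun _ => zero_le) ?_
  -- For `n ≥ 1`, `|r n| ≤ |n * r n|`, so the hypothesis on `n * r n` controls `r n`.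
  filter_upwards [eventually_gt_atTop 0] with n hn
  refine (measure_mono_ae ?_).trans (measure_union_le _ _)
  filter_upwards [hnear n, hident.mem_param n] with ω hω hθ hlarge
  by_contra hcon
  have hlarge' : δ ≤ ‖θhat n ω - θ₀‖ := hlarge
  have hcon' : ω ∉ _ ∧ ω ∉ _ := not_or.1 hcon
  simp only [Set.mem_ofPred_eq, not_le, sub_zero, Real.norm_eq_abs] at hcon'
  obtain ⟨hunif, hrn⟩ := hcon'
  have hdev : ∀ θ ∈ Θ, |MEst.sampleCrit m n (fun i => z i ω) θ - MEst.popCrit Q m θ| < κ :=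
    fun θ hθ => (ENNReal.ofReal_lt_ofReal_iff hκ0).1 ((le_iSup₂ (f := fun θ (_ : θ ∈ Θ) =>
      ENNReal.ofReal |MEst.sampleCrit m n (fun i => z i ω) θ - MEst.popCrit Q m θ|)
      θ hθ).trans_lt hunif)
  have hn1 : (1 : ℝ) ≤ n := by exact_mod_cast hn
  have hr' : |r n ω| < κ := by
    refine lt_of_le_of_lt ?_ hrn
    rw [abs_mul, Nat.abs_cast]
    exact le_mul_of_one_le_left (abs_nonneg _) hn1
  have hθ₀ := interior_subset hident.mem_interior
  have h1 := abs_lt.1 (hdev _ hθ)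
  have h2 := abs_lt.1 (hdev _ hθ₀)
  have h3 := hω _ hθ₀
  have h4 : (MEst.popCrit Q m (θhat n ω) : EReal) < γ :=
    (le_iSup₂ (f := fun θ (_ : θ ∈ {θ ∈ Θ | δ ≤ ‖θ - θ₀‖}) => (MEst.popCrit Q m θ : EReal))
      (θhat n ω) ⟨hθ, hlarge'⟩).trans_lt hγ1
  have h5 := EReal.coe_lt_coe_iff.1 h4
  have h6 : MEst.popCrit Q m θ₀ - γ = 3 * κ := by rw [hκ]; ring
  linarith [h1.2, h2.1, (abs_lt.1 hr').2]

end Consistency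

/-! ### Assembly -/

/-- **Asymptotic normality of M-estimators** under identification and regularity. -/
theorem tendstoInDistribution_estimator {Ω Z : Type*} [MeasurableSpace Ω] [MeasurableSpace Z]
    {P : Measure Ω} [IsProbabilityMeasure P] {Q : Measure Z} [IsProbabilityMeasure Q]
    {p : ℕ} {m : Z → EuclideanSpace ℝ (Fin p) → ℝ} {z : ℕ → Ω → Z}
    (hlaw : ∀ i, HasLaw (z i) Q P) (hindep : iIndepFun z P)
    {Θ : Set (EuclideanSpace ℝ (Fin p))} {θ₀ : EuclideanSpace ℝ (Fin p)}
    {θhat : ℕ → Ω → EuclideanSpace ℝ (Fin p)} (hθhat : ∀ n, AEMeasurable (θhat n) P)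
    (hident : MEst.Identification P Q m z Θ θ₀ θhat) (hreg : MEst.Regularity Q m Θ θ₀) :
    TendstoInDistribution (fun (n : ℕ) ω => √(n : ℝ) • (θhat n ω - θ₀)) atTop
      (id : EuclideanSpace ℝ (Fin p) → EuclideanSpace ℝ (Fin p)) (fun _ => P)
      (multivariateGaussian 0
        ((MEst.matA Q m θ₀)⁻¹ * MEst.matB Q m θ₀ * ((MEst.matA Q m θ₀)⁻¹)ᵀ)) := by
  obtain ⟨R, L, hΘ, hm⟩ := exists_locallyLipschitz hident.integrable hident.mem_interior hreg
  have hmemΘ : ∀ θ, ‖θ - θ₀‖ ≤ R → θ ∈ Θ := fun θ hθ => hΘ (mem_closedBall_iff_norm.2 hθ)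
  set A := MEst.matA Q m θ₀ with hA
  set T := Matrix.toEuclideanCLM (𝕜 := ℝ) A with hT
  set W := Matrix.toEuclideanCLM (𝕜 := ℝ) A⁻¹ with hW
  have hAt : Aᵀ = A := by
    have := hreg.posDef.isHermitian
    rwa [Matrix.IsHermitian, Matrix.conjTranspose_eq_transpose_of_trivial] at this
  obtain ⟨c, hc, hpos⟩ := exists_coercive hreg.posDef
  have hTW : ∀ g, T (W g) = g := fun g => by
    have h1 : T * W = 1 := by
      rw [hT, hW, ← map_mul, Matrix.mul_nonsing_inv _ (A.isUnit_iff_isUnit_det.1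
        hreg.posDef.isUnit), map_one]
    exact congrArg (fun f => f g) h1
  have hsymm : ∀ x y, inner ℝ (T x) y = inner ℝ x (T y) := fun x y => by
    rw [hT, inner_toEuclideanCLM_left, hAt]
  have hexp : (fun θ => ∫ x, m x θ ∂Q - ∫ x, m x θ₀ ∂Q + 1 / 2 * inner ℝ (T (θ - θ₀)) (θ - θ₀))
      =o[𝓝 θ₀] fun θ => ‖θ - θ₀‖ ^ 2 := by
    refine hreg.expansion.congr_left fun θ => ?_
    rw [hT, inner_toEuclideanCLM]
    simp only [MEst.popCrit, ← hA]
    ring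
  obtain ⟨r, hr, hnear⟩ := hident.near_max
  have hψ0 : ∫ x, MEst.score m x θ₀ ∂Q = 0 := hm.integral_grad_eq_zero fun θ hθ => by
    by_cases h : θ = θ₀
    · rw [h]
    · exact (hident.unique_max θ (hmemΘ θ hθ) h).le
  -- The linearization works with sums rather than averages, hence the error `n * r n`; at `n = 0`
  -- all sums are empty.
  have hlin := fun ε hε => hm.tendsto_linearization (ε := ε) (ρ := fun n ω => n * r n ω)
    hlaw hindep hc hsymm hpos hTW hexp (fun δ hδ => tendsto_meas_norm_sub_ge hident hδ)
    (fun δ hδ => by simpa using (tendstoInMeasure_iff_norm.1 hr) δ hδ)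
    (fun n => by
      filter_upwards [hnear n] with ω hω θ hθ
      rcases Nat.eq_zero_or_pos n with rfl | hn
      · simp
      have hn' : (0 : ℝ) < n := by exact_mod_cast hn
      have h1 := mul_le_mul_of_nonneg_left (hω θ (hmemΘ θ hθ)) hn'.le
      simp only [MEst.sampleCrit, mul_sub, mul_inv_cancel_left₀ hn'.ne'] at h1
      linarith) hε
  have hψ2 : MemLp (fun x => MEst.score m x θ₀) 2 Q :=
    ((memLp_two_iff_integrable_sq hm.measurable_const.aestronglyMeasurable).2
      hm.integrable_sq).mono' hm.measurable_grad (Eventually.of_forall hm.norm_grad_le)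
  have hVpos : (A⁻¹ * MEst.matB Q m θ₀ * (A⁻¹)ᵀ).PosSemidef := by
    rw [← Matrix.conjTranspose_eq_transpose_of_trivial]
    exact (posSemidef_matB hψ2).mul_mul_conjTranspose_same _
  have hclt := tendstoInDistribution_scoreSum hlaw hindep
    (ξ := fun x => W (MEst.score m x θ₀)) (W.comp_memLp' hψ2)
    (by rw [W.integral_comp_comm hm.integrable_grad, hψ0, map_zero]) hVpos (fun t => by
      simp_rw [hW, inner_toEuclideanCLM_left]
      rw [← dotProduct_matB_mulVec hψ2, Matrix.ofLp_toEuclideanCLM, ← Matrix.mulVec_mulVec,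
        ← Matrix.mulVec_mulVec, Matrix.dotProduct_mulVec t.ofLp, Matrix.mulVec_transpose])
  -- Slutsky: the estimator differs negligibly from the score sum of `W ψ`, where `W = A⁻¹` passes
  -- through the sum by linearity.
  refine tendstoInDistribution_of_tendstoInMeasure_sub _ _ hclt ?_
    fun n => ((hθhat n).sub_const _).fun_const_smul _
  refine tendstoInMeasure_iff_norm.2 fun ε hε => ?_
  refine (hlin ε hε).congr fun n => ?_
  have : ∀ ω, W (scoreSum (fun x => MEst.score m x θ₀) z n ω)
      = scoreSum (fun x => W (MEst.score m x θ₀)) z n ω := fun ω => by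
    simp [scoreSum]
  simp [this]

end MEstimation

/-- Asymptotic normality of the emulator-based estimator under misspecification. -/
theorem theorem6 {Ω 𝒳 : Type*} [MeasurableSpace Ω] [MeasurableSpace 𝒳] {K p : ℕ}
    (P : Measure Ω) [IsProbabilityMeasure P]
    (Q : Measure (Fin K × 𝒳)) [IsProbabilityMeasure Q]
    -- the observations `(y i, X i)` are iid with law `Q`
    (y : ℕ → Ω → Fin K) (X : ℕ → Ω → 𝒳)
    (hlaw : ∀ i, HasLaw (fun ω => (y i ω, X i ω)) Q P)
    (hindep : iIndepFun (fun i ω => (y i ω, X i ω)) P)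
    -- parameter space, utilities, scale matrix, fixed emulator
    (Θ : Set (EuclideanSpace ℝ (Fin p)))
    (v : 𝒳 → EuclideanSpace ℝ (Fin p) → Fin K → ℝ)
    (S : 𝒳 → EuclideanSpace ℝ (Fin p) → Matrix (Fin K) (Fin K) ℝ)
    (htrace : ∀ x, ∀ θ ∈ Θ, 0 < (Emulator.centeredScale (S x θ)).trace)
    (Phat : Fin K → (Fin K → ℝ) → Matrix (Fin K) (Fin K) ℝ → ℝ)
    (hPhat : ∀ z, ∀ θ ∈ Θ, 0 < Emulator.choiceProb Phat v S z θ)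
    -- pseudo-true parameter and estimator
    (θ₀ : EuclideanSpace ℝ (Fin p))
    (θhat : ℕ → Ω → EuclideanSpace ℝ (Fin p)) (hθhat : ∀ n, AEMeasurable (θhat n) P)
    (hident : MEst.Identification P Q (Emulator.logLik Phat v S)
      (fun i ω => (y i ω, X i ω)) Θ θ₀ θhat)
    (hreg : MEst.Regularity Q (Emulator.logLik Phat v S) Θ θ₀) :
    TendstoInDistribution (fun (n : ℕ) ω => Real.sqrt n • (θhat n ω - θ₀)) atTop
      (id : EuclideanSpace ℝ (Fin p) → EuclideanSpace ℝ (Fin p)) (fun _ => P)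
      (multivariateGaussian 0
        ((MEst.matA Q (Emulator.logLik Phat v S) θ₀)⁻¹ *
          MEst.matB Q (Emulator.logLik Phat v S) θ₀ *
          ((MEst.matA Q (Emulator.logLik Phat v S) θ₀)⁻¹)ᵀ)) := by
  exact MEstimation.tendstoInDistribution_estimator hlaw hindep hθhat hident hreg
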